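/- Let $\pi:\mathcal{X}\to\mathbb{P}^1\times\mathbb{P}^1$ and $\bar\pi:\bar{\mathcal{X}}\to\mathbb{P}^1\times\mathbb{P}^1$ be complex surfaces obtained from $\mathbb{P}^1\times\mathbb{P}^1$ by finite sequences of blowups of points (possibly infinitely near), with blowdown maps $\pi,\bar\pi$. Let $\tilde\varphi:\mathcal{X}\dashrightarrow\bar{\mathcal{X}}$ be a dominant rational map, written in affine coordinates as $(x,y)\mapsto(\bar x,\bar y)=(f(x,y),g(x,y))$ with $f,g\in\mathbb{C}(x,y)$, and let $\tilde\varphi^*$ denote the pull-back of rational functions (substitution $\bar x=f$, $\bar y=g$) and of divisors (pull-back of local equations). Let $\bar D_1$ and $\bar D_2$ be linearly equivalent divisors on $\bar{\mathcal{X}}$, and let $$\bar D_i=\sum_{j=1}^{J_i}n_{i,j}\,\bar D_{i,j}\quad(i=1,2),\qquad \tilde\varphi^*(\bar D_{i,j})=\sum_{k=1}^{K_{i,j}}m_{i,j,k}\,D_{i,j,k}$$ be decompositions into distinct irreducible divisors, with multiplicities $n_{i,j}\in\mathbb{Z}$, $m_{i,j,k}\in\mathbb{N}$. Let $\bar p_{i,j}(\bar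 x,\bar y)$ and $p_{i,j,k}(x,y)$ be irreducible defining polynomials, in the affine coordinates, of $\bar\pi_*(\bar D_{i,j})$ and $\pi_*(D_{i,j,k})$ respectively, where the defining polynomial is taken to be $1$ if the divisor is contracted by the blowdown map (its push-forward is $0$) or if its push-forward is one of the lines at infinity $x=\infty$, $y=\infty$. Then there is a nonzero constant $C\in\mathbb{C}$ such that, in $\mathbb{C}(x,y)$, after the substitution $(\bar x,\bar y)=(f(x,y),g(x,y))$, $$\frac{\prod_{j=1}^{J_1}\bar p_{1,j}(\bar x,\bar y)^{n_{1,j}}}{\prod_{j=1}^{J_2}\bar p_{2,j}(\bar x,\bar y)^{n_{2,j}}} = C\,\frac{\prod_{j=1}^{J_1}\Bigl(\prod_{k=1}^{K_{1,j}}p_{1,j,k}(x,y)^{m_{1,j,k}}\Bigr)^{n_{1,j}}}{\prod_{j=1}^{J_2}\Bigl(\prod_{k=1}^{K_{2,j}}p_{2,j,k}(x,y)^{m_{2,j,k}}\Bigr)^{n_{2,j}}}.$$ -/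

import Mathlib

noncomputable section

namespace BlowupSurfaces

/-- The polynomial ring `ℂ[x, y]` of the affine chart of `ℙ¹ × ℙ¹` with coordinates `(x, y)`. -/
abbrev Poly : Type := MvPolynomial (Fin 2) ℂ

/-- The field `ℂ(x, y)` of rational functions on `ℙ¹ × ℙ¹`. -/
abbrev Fn : Type := FractionRing Poly

/-- A polynomial seen as a rational function. -/
abbrev Poly.toFn (p : Poly) : Fn := algebraMap Poly Fn p

/-- The coordinate functions: `coord 0` is `x` and `coord 1` is `y`. -/
def coord (i : Fin 2) : Fn := Poly.toFn (MvPolynomial.X i)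

/-!
Surfaces birational to `ℙ¹ × ℙ¹`, with function field identified with `ℂ(x, y)`, are described in
the classical language of Zariski models: a surface is the set of the local rings, inside
`ℂ(x, y)`, of its scheme-theoretic points (the generic point, the curves, the closed points).
`R ≤ S` for local subrings means that `S` dominates `R`, and
`R.toSubring ≤ S.toSubring`, for two points of a surface, means that the first point is a
specialization of the second: the first point lies on the closure of the second.
-/

/-- The coordinate ring `ℂ[s, t]` of the chart of `ℙ¹ × ℙ¹` with coordinates `s = x` or `x⁻¹`
(according to `ε 0`) and `t = y` or `y⁻¹` (according to `ε 1`). -/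
def chartRing (ε : Fin 2 → Bool) : Subring Fn :=
  (Algebra.adjoin ℂ
    (Set.range fun i => if ε i then coord i else (coord i)⁻¹)).toSubring

/-- The local rings of `ℙ¹ × ℙ¹`: the localizations of the four affine coordinate rings at their
prime ideals. -/
def p1p1Points : Set (LocalSubring Fn) :=
  {R | ∃ (ε : Fin 2 → Bool) (P : Ideal (chartRing ε)) (_ : P.IsPrime),
    R = LocalSubring.ofPrime (chartRing ε) P}

/-- `R` is the local ring of a closed point: its residue field is `ℂ`, that is, each element of
`R` is congruent to a constant (its value at the point) modulo the maximal ideal. -/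
def IsClosedPoint (R : LocalSubring Fn) : Prop :=
  ∀ f : R.toSubring, ∃ (c : ℂ) (m : R.toSubring),
    m ∈ IsLocalRing.maximalIdeal R.toSubring ∧ (f : Fn) = algebraMap ℂ Fn c + (m : Fn)

/-- For an element `a` of the maximal ideal `𝔪` of `R`, the coordinate ring `R[𝔪 / a]` of the
corresponding affine chart of the blowup of `Spec R` at its closed point. -/
def blowupChart (R : LocalSubring Fn) (a : Fn) : Subring Fn :=
  Subring.closure ((R.toSubring : Set Fn) ∪
    {z | ∃ m : R.toSubring, m ∈ IsLocalRing.maximalIdeal R.toSubring ∧ z = (m : Fn) / a})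

/-- The local rings of the points lying over the closed point in the blowup of `Spec R` at its
closed point: the localizations of the rings `R[𝔪 / a]`, `0 ≠ a ∈ 𝔪`, at prime ideals, that
dominate `R`. -/
def exceptionalPoints (R : LocalSubring Fn) : Set (LocalSubring Fn) :=
  {S | R ≤ S ∧ ∃ a : R.toSubring, a ∈ IsLocalRing.maximalIdeal R.toSubring ∧ a ≠ 0 ∧
    ∃ (P : Ideal (blowupChart R a)) (_ : P.IsPrime),
      S = LocalSubring.ofPrime (blowupChart R a) P}

/-- The local rings of the blowup of a surface at its point `R`: the point is replaced by the
points over it, all other points are kept. -/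
def blowupPoints (X : Set (LocalSubring Fn)) (R : LocalSubring Fn) : Set (LocalSubring Fn) :=
  {S | S ∈ X ∧ S ≠ R} ∪ exceptionalPoints R

/-- Sets of local rings of surfaces obtained from `ℙ¹ × ℙ¹` by a finite sequence of blowups of
closed points (which may lie on the exceptional curves of earlier blowups). -/
inductive IsIteratedBlowup : Set (LocalSubring Fn) → Prop
  | base : IsIteratedBlowup p1p1Points
  | blowup (X : Set (LocalSubring Fn)) (R : LocalSubring Fn) (hX : IsIteratedBlowup X)
      (hR : R ∈ X) (hc : IsClosedPoint R) : IsIteratedBlowup (blowupPoints X R)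

/-- A surface obtained from `ℙ¹ × ℙ¹` by a finite sequence of blowups of closed points, together
with its blowdown map to `ℙ¹ × ℙ¹` (which identifies its function field with `ℂ(x, y)`). -/
structure Surface where
  /-- The local rings of the points of the surface. -/
  points : Set (LocalSubring Fn)
  isIteratedBlowup : IsIteratedBlowup points

/-- The surface `ℙ¹ × ℙ¹` itself. -/
def P1P1 : Surface := ⟨p1p1Points, .base⟩

/-- A prime divisor (irreducible curve) on a surface, given by the local ring of the surface along
the curve: the points of codimension one are those whose local ring is a discrete valuation
ring. -/
structure PrimeDivisor (X : Surface) where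
  /-- The local ring of the surface along the curve. -/
  ring : LocalSubring Fn
  mem_points : ring ∈ X.points
  isDVR : IsDiscreteValuationRing ring.toSubring

/-- The group of divisors on a surface. -/
abbrev Divisor (X : Surface) : Type := PrimeDivisor X →₀ ℤ

/-- The (nonzero) rational function `f` vanishes to order exactly `n` along the prime divisor `E`:
`f = u ϖ ^ n` with a unit `u` and a uniformizer `ϖ` of the local ring along `E`. -/
def HasOrd {X : Surface} (E : PrimeDivisor X) (f : Fn) (n : ℤ) : Prop :=
  ∃ ϖ u : E.ring.toSubring, Irreducible ϖ ∧ IsUnit u ∧ f = (u : Fn) * (ϖ : Fn) ^ n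

/-- Linear equivalence: the difference is the divisor of a rational function. -/
def LinearlyEquivalent {X : Surface} (D₁ D₂ : Divisor X) : Prop :=
  ∃ f : Fn, ∀ E : PrimeDivisor X, HasOrd E f (D₁ E - D₂ E)

/-- `g` is a local equation of the divisor `D` at the point with local ring `R`: `g` vanishes to
order `D E` along each prime divisor `E` passing through the point. -/
def IsLocalEquation {X : Surface} (D : Divisor X) (R : LocalSubring Fn) (g : Fn) : Prop :=
  ∀ E : PrimeDivisor X, R.toSubring ≤ E.ring.toSubring → HasOrd E g (D E)

/-- A dominant rational map between two surfaces obtained from `ℙ¹ × ℙ¹` by blowups. In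
coordinates it is `(x, y) ↦ (x̄, ȳ) = (φ₀(x, y), φ₁(x, y))` with rational functions `φ₀, φ₁`; it
is dominant when the image lies on no curve, that is, when `φ₀, φ₁` satisfy no nontrivial
polynomial relation. -/
structure DominantRationalMap where
  /-- The two components of the map. -/
  component : Fin 2 → Fn
  dominant : AlgebraicIndependent ℂ component

/-- The pull-back `φ^* : ℂ(x̄, ȳ) → ℂ(x, y)` of rational functions, by substitution. -/
def DominantRationalMap.pullbackFn (φ : DominantRationalMap) : Fn →ₐ[ℂ] Fn :=
  IsFractionRing.liftAlgHom (g := MvPolynomial.aeval φ.component) φ.dominant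

/-- `D` is the pull-back (total transform) `φ^* D'` of the divisor `D'` under the rational map
`φ : X ⇢ X'`. Along every prime divisor `E` of `X`, the map `φ` is defined at the generic point
of `E`, and sends it to the point `R` of `X'` whose local ring is dominated by that of `E`
via `φ^*`; the multiplicity of `φ^* D'` along `E` is the order of the pull-back of a local
equation `g` of `D'` at `R`. -/
def IsPullback {X X' : Surface} (φ : DominantRationalMap) (D' : Divisor X') (D : Divisor X) :
    Prop :=
  ∀ E : PrimeDivisor X, ∃ R ∈ X'.points, R.map (φ.pullbackFn : Fn →+* Fn) ≤ E.ring ∧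
    ∃ g : Fn, IsLocalEquation D' R g ∧ HasOrd E (φ.pullbackFn g) (D E)

open scoped Classical in
/-- The push-forward `π_* E` of a prime divisor `E` under the blowdown map `π : X → ℙ¹ × ℙ¹`. The
map `π` is birational, so this is the image of `E`, with the same local ring, if the image is a
curve; and it is `0` if `E` is contracted to a point. -/
def pushforward {X : Surface} (E : PrimeDivisor X) : Divisor P1P1 :=
  if h : E.ring ∈ P1P1.points then
    Finsupp.single (⟨E.ring, h, E.isDVR⟩ : PrimeDivisor P1P1) 1
  else 0

/-- The curve `C` on `ℙ¹ × ℙ¹` meets the affine chart with coordinates `(x, y)`, that is, it is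
neither `x = ∞` nor `y = ∞`. -/
def MeetsAffineChart (C : PrimeDivisor P1P1) : Prop :=
  ∀ q : Poly, Poly.toFn q ∈ C.ring.toSubring

/-- The curve `C` is `V(p)`: the local ring along `C` is the localization of `ℂ[x, y]` at the
prime ideal generated by `p`. -/
def IsZeroLocus (C : PrimeDivisor P1P1) (p : Poly) : Prop :=
  ∀ z : Fn, z ∈ C.ring.toSubring ↔ ∃ a b : Poly, ¬ p ∣ b ∧ z = Poly.toFn a / Poly.toFn b

/-- `p` is an irreducible defining polynomial, in the affine coordinates `(x, y)`, of `D`, which is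
a prime divisor on `ℙ¹ × ℙ¹` or zero: either `D` is an irreducible curve that meets the affine
chart, and `p` is irreducible with `D = V(p)`; or no component of `D` meets the affine chart (`D`
is zero, `x = ∞` or `y = ∞`), and `p = 1`. -/
def IsDefiningPolynomial (p : Poly) (D : Divisor P1P1) : Prop :=
  (∃ C : PrimeDivisor P1P1, D = Finsupp.single C 1 ∧ Irreducible p ∧ IsZeroLocus C p) ∨
    ((∀ C : PrimeDivisor P1P1, MeetsAffineChart C → D C = 0) ∧ p = 1)

end BlowupSurfaces

end

/-! A rational function without zeros or poles along the curves of the affine plane is a nonzero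
constant, because `ℂ[x, y]` is factorial with units `ℂ \ {0}`. So functions may be compared by their
orders along the strict transforms of affine curves alone. Contracted curves and lines at infinity
are never tested, which is why their defining polynomial may be `1`.

Let `F` have divisor `D' 0 - D' 1` on `X'`. Up to a constant, `F` is the quotient of the products of
the `p'`, since the orders agree (`hasOrd_definingPolynomial`, `exists_eq_mul_of_hasOrd`). On `X`,
the pull-back of `F` is compared with the quotient of the products of the `p`. Let `B` be a prime
divisor of `X` whose generic point goes to `R`. Both `F` and the product of powers of the local
equations chosen in `IsPullback` are local equations of `D' 0 - D' 1` at `R`, so they differ by a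
unit of `R`, and their pull-backs have the same order along `B`. Eliminating `F` gives the formula.

Two properties of `X'` enter. Local rings that are localizations of factorial rings make a function
of order zero along all curves through `R` a unit of `R`. Separatedness makes `R` the same for all
components. Both belong to `IsSmoothModel`, which is proved by induction on the blowups. -/

noncomputable section

namespace BlowupSurfaces

/-! ### Domination and localization of local subrings of a field -/

section LocalSubrings

variable {K : Type*} [Field K]

theorem isUnit_iff_inv_mem {A : Subring K} (x : A) : IsUnit x ↔ (x : K) ≠ 0 ∧ (x : K)⁻¹ ∈ A := by
  constructor
  · rintro ⟨u, rfl⟩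
    have h : ((u : A) : K) * ((u⁻¹ : Aˣ) : A) = 1 := by
      exact_mod_cast congrArg (Subtype.val) (Units.mul_inv u)
    have h0 : ((u : A) : K) ≠ 0 := left_ne_zero_of_mul_eq_one h
    refine ⟨h0, ?_⟩
    rw [← eq_inv_of_mul_eq_one_right h]
    exact SetLike.coe_mem _
  · rintro ⟨h0, h⟩
    exact IsUnit.of_mul_eq_one ⟨_, h⟩ (Subtype.ext (mul_inv_cancel₀ h0))

theorem mem_maximalIdeal_iff {R : LocalSubring K} (x : R.toSubring) :
    x ∈ IsLocalRing.maximalIdeal R.toSubring ↔ (x : K) = 0 ∨ (x : K)⁻¹ ∉ R.toSubring := by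
  rw [IsLocalRing.mem_maximalIdeal, mem_nonunits_iff, isUnit_iff_inv_mem]
  tauto

theorem inv_mem_of_add_inv_mem {R : LocalSubring K} {x y : K} (hx : x ∈ R.toSubring)
    (hy : y ∈ R.toSubring) (h0 : x + y ≠ 0) (h : (x + y)⁻¹ ∈ R.toSubring) :
    (x ≠ 0 ∧ x⁻¹ ∈ R.toSubring) ∨ (y ≠ 0 ∧ y⁻¹ ∈ R.toSubring) := by
  have hu : IsUnit ((⟨x, hx⟩ : R.toSubring) + ⟨y, hy⟩) :=
    (isUnit_iff_inv_mem _).2 ⟨h0, h⟩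
  exact (IsLocalRing.isUnit_or_isUnit_of_isUnit_add hu).imp
    (isUnit_iff_inv_mem _).1 (isUnit_iff_inv_mem _).1

theorem localSubring_le_iff {R S : LocalSubring K} :
    R ≤ S ↔ R.toSubring ≤ S.toSubring ∧
      ∀ x ∈ R.toSubring, x⁻¹ ∈ S.toSubring → x⁻¹ ∈ R.toSubring := by
  rw [LocalSubring.le_def]
  constructor
  · rintro ⟨h, hl⟩
    refine ⟨h, fun x hx hi => ?_⟩
    by_cases h0 : x = 0
    · subst h0; simp
    exact ((isUnit_iff_inv_mem (⟨x, hx⟩ : R.toSubring)).1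
      (hl.map_nonunit _ ((isUnit_iff_inv_mem _).2 ⟨h0, hi⟩))).2
  · rintro ⟨h, hl⟩
    refine ⟨h, ⟨fun x hx => ?_⟩⟩
    have := (isUnit_iff_inv_mem _).1 hx
    exact (isUnit_iff_inv_mem _).2 ⟨this.1, hl x x.2 this.2⟩

/-- The local ring `S` is a localization of its subring `A`. -/
def IsLocalizationOf (A : Subring K) (S : LocalSubring K) : Prop :=
  A ≤ S.toSubring ∧ ∀ z ∈ S.toSubring, ∃ a ∈ A, ∃ b ∈ A, b ≠ 0 ∧ b⁻¹ ∈ S.toSubring ∧ z = a / b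

theorem IsLocalizationOf.trans {A : Subring K} {R S : LocalSubring K}
    (h₁ : IsLocalizationOf A R) (h₂ : IsLocalizationOf R.toSubring S) : IsLocalizationOf A S := by
  refine ⟨h₁.1.trans h₂.1, fun z hz => ?_⟩
  obtain ⟨x, hx, y, hy, y0, yi, rfl⟩ := h₂.2 z hz
  obtain ⟨a, ha, b, hb, b0, bi, rfl⟩ := h₁.2 x hx
  obtain ⟨c, hc, d, hd, d0, di, rfl⟩ := h₁.2 y hy
  have c0 : c ≠ 0 := fun h => y0 (by simp [h])
  refine ⟨a * d, mul_mem ha hd, b * c, mul_mem hb hc, mul_ne_zero b0 c0, ?_, by field_simp⟩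
  have : (b * c)⁻¹ = b⁻¹ * (d⁻¹ * (c / d)⁻¹) := by field_simp
  rw [this]
  exact mul_mem (h₂.1 bi) (mul_mem (h₂.1 di) yi)

/-- A denominator from `A` that is invertible in `S` is invertible in `V`, hence already in `T`,
because `T ≤ V` is local. All separatedness arguments reduce to this. -/
theorem IsLocalizationOf.toSubring_le {A : Subring K} {S T V : LocalSubring K}
    (h : IsLocalizationOf A S) (hA : A ≤ T.toSubring) (hS : S.toSubring ≤ V.toSubring)
    (hT : T ≤ V) : S.toSubring ≤ T.toSubring := by
  intro z hz
  obtain ⟨a, ha, b, hb, b0, bi, rfl⟩ := h.2 z hz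
  rw [div_eq_mul_inv]
  exact mul_mem (hA ha) ((localSubring_le_iff.1 hT).2 b (hA hb) (hS bi))

theorem IsLocalizationOf.eq_of_le {A : Subring K} {S T : LocalSubring K}
    (h : IsLocalizationOf A S) (hA : A ≤ T.toSubring) (hT : T ≤ S) : S = T :=
  LocalSubring.toSubring_injective
    (le_antisymm (h.toSubring_le hA le_rfl hT) (LocalSubring.toSubring_mono hT))

theorem inv_mem_ofPrime {A : Subring K} {P : Ideal A} [P.IsPrime] {a : A} (ha : a ∉ P) :
    (a : K)⁻¹ ∈ (LocalSubring.ofPrime A P).toSubring :=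
  ((isUnit_iff_inv_mem _).1 (IsLocalization.map_units (LocalSubring.ofPrime A P).toSubring
    (⟨a, ha⟩ : P.primeCompl))).2

theorem mem_ofPrime {A : Subring K} {P : Ideal A} [P.IsPrime] {z : K} :
    z ∈ (LocalSubring.ofPrime A P).toSubring ↔ ∃ a b : A, b ∉ P ∧ z = (a : K) / b := by
  constructor
  · intro hz
    obtain ⟨a, b, hab⟩ := IsLocalization.exists_mk'_eq P.primeCompl
      (⟨z, hz⟩ : (LocalSubring.ofPrime A P).toSubring)
    refine ⟨a, b, b.2, ?_⟩
    have h := IsLocalization.mk'_spec (LocalSubring.ofPrime A P).toSubring a b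
    rw [hab] at h
    have h' : z * (b : A) = (a : K) := congrArg Subtype.val h
    have b0 : ((b : A) : K) ≠ 0 := fun h0 => b.2 (by
      have : (b : A) = 0 := Subtype.ext h0
      rw [this]; exact zero_mem P)
    exact eq_div_of_mul_eq b0 h'
  · rintro ⟨a, b, hb, rfl⟩
    rw [div_eq_mul_inv]
    exact mul_mem (LocalSubring.le_ofPrime A P a.2) (inv_mem_ofPrime hb)

theorem isLocalizationOf_ofPrime (A : Subring K) (P : Ideal A) [P.IsPrime] :
    IsLocalizationOf A (LocalSubring.ofPrime A P) := by
  refine ⟨LocalSubring.le_ofPrime A P, fun z hz => ?_⟩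
  obtain ⟨a, b, hb, rfl⟩ := mem_ofPrime.1 hz
  refine ⟨a, a.2, b, b.2, fun h0 => hb ?_, inv_mem_ofPrime hb, rfl⟩
  have : b = 0 := Subtype.ext h0
  rw [this]; exact zero_mem P

/-- A local ring containing `A` dominates the localization of `A` at its center. -/
theorem exists_ofPrime_le {A : Subring K} {V : LocalSubring K} (h : A ≤ V.toSubring) :
    ∃ (P : Ideal A) (_ : P.IsPrime), LocalSubring.ofPrime A P ≤ V := by
  let P : Ideal A := (IsLocalRing.maximalIdeal V.toSubring).comap (Subring.inclusion h)
  have hP : P.IsPrime := Ideal.comap_isPrime _ _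
  have key : ∀ b : A, b ∉ P → (b : K) ≠ 0 ∧ (b : K)⁻¹ ∈ V.toSubring := by
    intro b hb
    have : ¬ ((b : K) = 0 ∨ (b : K)⁻¹ ∉ V.toSubring) :=
      fun h' => hb ((mem_maximalIdeal_iff (Subring.inclusion h b)).2 h')
    tauto
  refine ⟨P, hP, localSubring_le_iff.2 ⟨fun z hz => ?_, fun z hz hi => ?_⟩⟩
  · obtain ⟨a, b, hb, rfl⟩ := mem_ofPrime.1 hz
    rw [div_eq_mul_inv]
    exact mul_mem (h a.2) (key b hb).2
  · obtain ⟨a, b, hb, rfl⟩ := mem_ofPrime.1 hz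
    by_cases a0 : (a : K) = 0
    · simp [a0]
    rw [inv_div]
    refine mem_ofPrime.2 ⟨b, a, fun ha => ?_, rfl⟩
    rcases (mem_maximalIdeal_iff (Subring.inclusion h a)).1 ha with h' | h'
    · exact a0 h'
    · apply h'
      have : (a : K)⁻¹ = ((a : K) / b)⁻¹ * (b : K)⁻¹ := by
        have := (key b hb).1
        field_simp
      change (a : K)⁻¹ ∈ _
      rw [this]
      exact mul_mem hi (key b hb).2

/-- The prime is the center of `S` on `A`. Points can thus be handled through `IsLocalizationOf`,
with no ideal to carry along. -/
theorem IsLocalizationOf.exists_eq_ofPrime {A : Subring K} {S : LocalSubring K}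
    (h : IsLocalizationOf A S) :
    ∃ (P : Ideal A) (_ : P.IsPrime), S = LocalSubring.ofPrime A P := by
  obtain ⟨P, hP, hle⟩ := exists_ofPrime_le h.1
  exact ⟨P, hP, h.eq_of_le (LocalSubring.le_ofPrime A P) hle⟩

theorem isDVR_ofPrime_span {A : Subring K} [IsNoetherianRing A] {q : A} (hq : Prime q)
    [hP : (Ideal.span {q}).IsPrime] :
    IsDiscreteValuationRing (LocalSubring.ofPrime A (Ideal.span {q})).toSubring := by
  set S := (LocalSubring.ofPrime A (Ideal.span {q})).toSubring
  have hN : IsNoetherianRing S :=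
    IsLocalization.isNoetherianRing (Ideal.span {q}).primeCompl S inferInstance
  have hmax : IsLocalRing.maximalIdeal S = Ideal.span {algebraMap A S q} := by
    rw [← IsLocalization.AtPrime.map_eq_maximalIdeal (Ideal.span {q}) S, Ideal.map_span,
      Set.image_singleton]
  have hf : ¬ IsField S := by
    rw [IsLocalRing.isField_iff_maximalIdeal_eq, hmax, Ideal.span_singleton_eq_bot]
    intro h
    exact hq.ne_zero (Subtype.ext (congrArg Subtype.val h : (q : K) = 0))
  have hp : (IsLocalRing.maximalIdeal S).IsPrincipal := ⟨⟨_, hmax⟩⟩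
  exact ((IsDiscreteValuationRing.TFAE S hf).out 0 4).2 hp

/-- A localization of a factorial ring is the intersection of its localizations that are discrete
valuation rings. -/
theorem IsLocalizationOf.exists_isDVR_notMem {A : Subring K} [UniqueFactorizationMonoid A]
    [IsNoetherianRing A] [IsFractionRing A K] {R : LocalSubring K} (h : IsLocalizationOf A R)
    {z : K} (hz : z ∉ R.toSubring) :
    ∃ S : LocalSubring K, IsLocalizationOf R.toSubring S ∧
      IsDiscreteValuationRing S.toSubring ∧ z ∉ S.toSubring := by
  obtain ⟨a, b, hab, rfl⟩ := IsFractionRing.exists_reduced_fraction (A := A) z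
  have b0 : (b : A) ≠ 0 := nonZeroDivisors.ne_zero b.2
  have b0' : ((b : A) : K) ≠ 0 := fun h => b0 (Subtype.ext h)
  have hzeq : IsLocalization.mk' K a b = (a : K) / (b : A) :=
    IsFractionRing.mk'_eq_div (A := A) (K := K) b
  rw [hzeq] at hz ⊢
  have hbi : ((b : A) : K)⁻¹ ∉ R.toSubring := fun hb =>
    hz (by rw [div_eq_mul_inv]; exact mul_mem (h.1 a.2) hb)
  -- If every prime factor of the reduced denominator `b` were invertible in `R`, so would be `b`. A
  -- prime factor `q` that is not gives the valuation ring `A_(q)`, which contains `R` but not `a /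
  -- b`.
  obtain ⟨q, hq, hqb, hqi⟩ : ∃ q : A, Prime q ∧ q ∣ b ∧ (q : K)⁻¹ ∉ R.toSubring := by
    by_contra! hcon
    have key : ∀ s : Multiset A, (∀ q ∈ s, Prime q ∧ q ∣ (b : A)) →
        ((s.prod : A) : K)⁻¹ ∈ R.toSubring := by
      intro s
      induction s using Multiset.induction with
      | empty => simp
      | cons q s ih =>
        intro hs
        rw [Multiset.prod_cons, Subring.coe_mul, mul_inv]
        refine mul_mem ?_ (ih fun q hq => hs q (Multiset.mem_cons_of_mem hq))
        have := hs q (Multiset.mem_cons_self q s)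
        exact hcon q this.1 this.2
    obtain ⟨s, hs, u, hu⟩ := UniqueFactorizationMonoid.exists_prime_factors (b : A) b0
    have h1 := key s fun q hq =>
      ⟨hs q hq, (Multiset.dvd_prod hq).trans (Dvd.intro _ hu)⟩
    apply hbi
    rw [← hu, Subring.coe_mul, mul_inv]
    exact mul_mem h1 (h.1 ((isUnit_iff_inv_mem _).1 u.isUnit).2)
  have hP : (Ideal.span {q}).IsPrime := (Ideal.span_singleton_prime hq.ne_zero).2 hq
  have hS := isLocalizationOf_ofPrime A (Ideal.span {q})
  refine ⟨LocalSubring.ofPrime A (Ideal.span {q}), ⟨fun x hx => ?_, fun x hx => ?_⟩,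
    isDVR_ofPrime_span hq, fun hmem => ?_⟩
  · obtain ⟨c, hc, d, hd, d0, di, rfl⟩ := h.2 x hx
    refine mem_ofPrime.2 ⟨⟨c, hc⟩, ⟨d, hd⟩, fun hdq => hqi ?_, rfl⟩
    obtain ⟨e, he⟩ := Ideal.mem_span_singleton.1 hdq
    have hde : d = (q : K) * e := congrArg Subtype.val he
    have e0 : (e : K) ≠ 0 := fun h0 => d0 (by rw [hde, h0, mul_zero])
    have : (q : K)⁻¹ = d⁻¹ * e := by
      rw [hde, mul_inv, mul_assoc, inv_mul_cancel₀ e0, mul_one]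
    rw [this]
    exact mul_mem di (h.1 e.2)
  · obtain ⟨c, hc, d, hd, d0, di, rfl⟩ := hS.2 x hx
    exact ⟨c, h.1 hc, d, h.1 hd, d0, di, rfl⟩
  · obtain ⟨c, d, hd, hcd⟩ := mem_ofPrime.1 hmem
    have d0 : (d : K) ≠ 0 := fun h0 => hd (by
      have : d = 0 := Subtype.ext h0
      rw [this]; exact zero_mem _)
    have heq : a * d = c * b := by
      apply Subtype.ext
      rw [div_eq_div_iff b0' d0] at hcd
      exact hcd
    have : q ∣ a * d := heq ▸ (hqb.mul_left c)
    rcases hq.dvd_or_dvd this with h' | h'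
    · exact hq.not_isUnit (hab h' hqb)
    · exact hd (Ideal.mem_span_singleton.2 h')

end LocalSubrings

/-! ### Polynomial rings in two generators of the function field -/

/-- The subring `ℂ[u, v]` of the field of rational functions. -/
def coordRing (u v : Fn) : Subring Fn := (Algebra.adjoin ℂ {u, v}).toSubring

/-- `u, v` generate the field of rational functions. -/
def GenerateFn (u v : Fn) : Prop := IntermediateField.adjoin ℂ {u, v} = ⊤

theorem left_mem_coordRing (u v : Fn) : u ∈ coordRing u v :=
  Algebra.subset_adjoin (by simp)

theorem right_mem_coordRing (u v : Fn) : v ∈ coordRing u v :=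
  Algebra.subset_adjoin (by simp)

theorem algebraMap_mem_coordRing (u v : Fn) (c : ℂ) : algebraMap ℂ Fn c ∈ coordRing u v :=
  (Algebra.adjoin ℂ {u, v}).algebraMap_mem c

theorem coordRing_le {u v : Fn} {A : Subring Fn} (hc : ∀ c : ℂ, algebraMap ℂ Fn c ∈ A)
    (hu : u ∈ A) (hv : v ∈ A) : coordRing u v ≤ A := by
  intro z hz
  induction hz using Algebra.adjoin_induction with
  | mem x hx =>
    rcases hx with rfl | rfl
    exacts [hu, hv]
  | algebraMap r => exact hc r
  | add x y _ _ hx hy => exact add_mem hx hy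
  | mul x y _ _ hx hy => exact mul_mem hx hy

theorem coordRing_comm (u v : Fn) : coordRing u v = coordRing v u := by
  rw [coordRing, coordRing, Set.pair_comm]

theorem GenerateFn.of_mem {u v u' v' : Fn} (h : GenerateFn u v)
    (hu : u ∈ IntermediateField.adjoin ℂ {u', v'}) (hv : v ∈ IntermediateField.adjoin ℂ {u', v'}) :
    GenerateFn u' v' := by
  rw [GenerateFn, ← top_le_iff, ← h, IntermediateField.adjoin_le_iff]
  rintro x (rfl | rfl)
  exacts [hu, hv]

theorem GenerateFn.symm {u v : Fn} (h : GenerateFn u v) : GenerateFn v u := by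
  rwa [GenerateFn, Set.pair_comm]

theorem GenerateFn.exists_div {u v : Fn} (h : GenerateFn u v) (z : Fn) :
    ∃ a b : coordRing u v, z = a / b := by
  have hz : z ∈ IntermediateField.adjoin ℂ {u, v} := by
    rw [show IntermediateField.adjoin ℂ {u, v} = ⊤ from h]
    exact IntermediateField.mem_top
  obtain ⟨r, hr, s, hs, hrs⟩ := IntermediateField.mem_adjoin_iff_div.1 hz
  exact ⟨⟨r, hr⟩, ⟨s, hs⟩, hrs⟩

theorem GenerateFn.isFractionRing {u v : Fn} (h : GenerateFn u v) :
    IsFractionRing (coordRing u v) Fn :=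
  IsFractionRing.of_field _ _ h.exists_div

theorem trdeg_fn : Algebra.trdeg ℂ Fn = 2 := by
  have : Algebra.IsAlgebraic Poly Fn := IsLocalization.isAlgebraic _ (nonZeroDivisors Poly)
  have :=
    ((IsTranscendenceBasis.mvPolynomial (Fin 2) ℂ).algebraMap_comp (A := Fn)).cardinalMk_eq_trdeg
  rw [← this, Cardinal.mk_fin, Nat.cast_ofNat]

/-- The field has transcendence degree 2, so two elements over which it is algebraic form a
transcendence basis. -/
theorem GenerateFn.algebraicIndependent {u v : Fn} (h : GenerateFn u v) :
    AlgebraicIndependent ℂ ![u, v] := by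
  have hr : Set.range ![u, v] = {u, v} := by simp [Set.pair_comm]
  have : IsFractionRing (Algebra.adjoin ℂ (Set.range ![u, v])) Fn := by
    rw [hr]; exact h.isFractionRing
  have : Algebra.IsAlgebraic (Algebra.adjoin ℂ (Set.range ![u, v])) Fn :=
    IsLocalization.isAlgebraic _ (nonZeroDivisors (Algebra.adjoin ℂ (Set.range ![u, v])))
  have := Algebra.IsAlgebraic.isTranscendenceBasis_of_le_trdeg_of_finite (R := ℂ) ![u, v]
    (by simp [trdeg_fn])
  exact this.1

/-- The isomorphism `ℂ[x, y] ≃ ℂ[u, v]`. -/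
def GenerateFn.equiv {u v : Fn} (h : GenerateFn u v) : Poly ≃+* coordRing u v :=
  h.algebraicIndependent.aevalEquiv.toRingEquiv.trans
    (Subalgebra.equivOfEq _ _ (by simp [Set.pair_comm]) :
      Algebra.adjoin ℂ (Set.range ![u, v]) ≃ₐ[ℂ] Algebra.adjoin ℂ {u, v}).toRingEquiv

theorem GenerateFn.uniqueFactorizationMonoid {u v : Fn} (h : GenerateFn u v) :
    UniqueFactorizationMonoid (coordRing u v) :=
  h.equiv.toMulEquiv.uniqueFactorizationMonoid inferInstance

theorem GenerateFn.isNoetherianRing {u v : Fn} (h : GenerateFn u v) :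
    IsNoetherianRing (coordRing u v) :=
  isNoetherianRing_of_ringEquiv _ h.equiv

theorem GenerateFn.left_ne_zero {u v : Fn} (h : GenerateFn u v) : u ≠ 0 :=
  h.algebraicIndependent.ne_zero 0

/-- This is the first-order expansion at the origin, with `c` as constant term. -/
theorem coordRing_exists_eq {u v a : Fn} (ha : a ∈ coordRing u v) :
    ∃ c : ℂ, ∃ α ∈ coordRing u v, ∃ β ∈ coordRing u v,
      a = algebraMap ℂ Fn c + (α * u + β * v) := by
  have hu := left_mem_coordRing u v
  have hv := right_mem_coordRing u v
  induction ha using Algebra.adjoin_induction with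
  | mem x hx =>
    rcases hx with rfl | rfl
    · exact ⟨0, 1, one_mem _, 0, zero_mem _, by simp⟩
    · exact ⟨0, 0, zero_mem _, 1, one_mem _, by simp⟩
  | algebraMap r => exact ⟨r, 0, zero_mem _, 0, zero_mem _, by simp⟩
  | add x y _ _ hx hy =>
    obtain ⟨c, α, hα, β, hβ, rfl⟩ := hx
    obtain ⟨d, γ, hγ, δ, hδ, rfl⟩ := hy
    exact ⟨c + d, α + γ, add_mem hα hγ, β + δ, add_mem hβ hδ, by rw [map_add]; ring⟩
  | mul x y _ hy' hx hy =>
    have hy'' : y ∈ coordRing u v := hy'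
    obtain ⟨c, α, hα, β, hβ, rfl⟩ := hx
    obtain ⟨d, γ, hγ, δ, hδ, hyd⟩ := hy
    refine ⟨c * d, α * y + algebraMap ℂ Fn c * γ, ?_, β * y + algebraMap ℂ Fn c * δ, ?_, ?_⟩
    · exact add_mem (mul_mem hα hy'') (mul_mem (algebraMap_mem_coordRing u v c) hγ)
    · exact add_mem (mul_mem hβ hy'') (mul_mem (algebraMap_mem_coordRing u v c) hδ)
    · rw [map_mul]
      linear_combination algebraMap ℂ Fn c * hyd

theorem nonunit_add {K : Type*} [Field K] {R : LocalSubring K} {x y : K} (hx : x ∈ R.toSubring)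
    (hy : y ∈ R.toSubring) (hx' : x = 0 ∨ x⁻¹ ∉ R.toSubring) (hy' : y = 0 ∨ y⁻¹ ∉ R.toSubring) :
    x + y = 0 ∨ (x + y)⁻¹ ∉ R.toSubring := by
  by_contra! h
  rcases inv_mem_of_add_inv_mem hx hy h.1 h.2 with h' | h' <;> tauto

theorem nonunit_mul {K : Type*} [Field K] {R : LocalSubring K} {x y : K} (hx : x ∈ R.toSubring)
    (hy' : y = 0 ∨ y⁻¹ ∉ R.toSubring) : x * y = 0 ∨ (x * y)⁻¹ ∉ R.toSubring := by
  by_contra! h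
  obtain ⟨h0, hi⟩ := h
  have x0 := left_ne_zero_of_mul h0
  have y0 := right_ne_zero_of_mul h0
  refine hy'.elim y0 fun h => h ?_
  have : y⁻¹ = x * (x * y)⁻¹ := by field_simp
  rw [this]
  exact mul_mem hx hi

/-- At the origin of the chart, `u` and `v` generate the maximal ideal: the constant term of the
numerator of `m` is a difference of nonunits, hence zero. -/
theorem exists_eq_of_nonunit {u v : Fn} {R : LocalSubring Fn}
    (h : IsLocalizationOf (coordRing u v) R) (hu : u = 0 ∨ u⁻¹ ∉ R.toSubring)
    (hv : v = 0 ∨ v⁻¹ ∉ R.toSubring) {m : Fn} (hm : m ∈ R.toSubring)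
    (hm' : m = 0 ∨ m⁻¹ ∉ R.toSubring) :
    ∃ α ∈ R.toSubring, ∃ β ∈ R.toSubring, m = α * u + β * v := by
  obtain ⟨a, ha, b, hb, b0, bi, rfl⟩ := h.2 m hm
  obtain ⟨c, α, hα, β, hβ, hab⟩ := coordRing_exists_eq ha
  have hur := h.1 (left_mem_coordRing u v)
  have hvr := h.1 (right_mem_coordRing u v)
  have hαβ := nonunit_add (mul_mem (h.1 hα) hur) (mul_mem (h.1 hβ) hvr)
    (nonunit_mul (h.1 hα) hu) (nonunit_mul (h.1 hβ) hv)
  have ha' : a = 0 ∨ a⁻¹ ∉ R.toSubring := by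
    have := nonunit_mul (h.1 hb) hm'
    rwa [mul_div_cancel₀ _ b0] at this
  have hc : c = 0 := by
    by_contra c0
    have h1 := nonunit_add (h.1 ha) (mul_mem (neg_mem (one_mem _))
        (add_mem (mul_mem (h.1 hα) hur) (mul_mem (h.1 hβ) hvr))) ha'
      (nonunit_mul (neg_mem (one_mem _)) hαβ)
    have h2 : a + -1 * (α * u + β * v) = algebraMap ℂ Fn c := by rw [hab]; ring
    rw [h2, ← map_inv₀] at h1
    rcases h1 with h1 | h1
    · exact c0 (by simpa using h1)
    · exact h1 (h.1 (algebraMap_mem_coordRing u v _))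
  refine ⟨α * b⁻¹, mul_mem (h.1 hα) bi, β * b⁻¹, mul_mem (h.1 hβ) bi, ?_⟩
  rw [hab, hc, map_zero]
  field_simp
  ring

/-! ### Charts of the blowup -/

theorem mem_blowupChart_left {R : LocalSubring Fn} {a x : Fn} (hx : x ∈ R.toSubring) :
    x ∈ blowupChart R a :=
  Subring.subset_closure (Or.inl hx)

theorem div_mem_blowupChart {R : LocalSubring Fn} {a x : Fn} (hx : x ∈ R.toSubring)
    (hx' : x = 0 ∨ x⁻¹ ∉ R.toSubring) : x / a ∈ blowupChart R a :=
  Subring.subset_closure (Or.inr ⟨⟨x, hx⟩, (mem_maximalIdeal_iff _).2 hx', rfl⟩)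

theorem blowupChart_le {R : LocalSubring Fn} {a : Fn} {A : Subring Fn} (hR : R.toSubring ≤ A)
    (h : ∀ x ∈ R.toSubring, (x = 0 ∨ x⁻¹ ∉ R.toSubring) → x / a ∈ A) : blowupChart R a ≤ A := by
  refine Subring.closure_le.2 ?_
  rintro z (hz | ⟨m, hm, rfl⟩)
  · exact hR hz
  · exact h m m.2 ((mem_maximalIdeal_iff _).1 hm)

theorem mem_exceptionalPoints_iff {R S : LocalSubring Fn} :
    S ∈ exceptionalPoints R ↔ R ≤ S ∧ ∃ a ∈ R.toSubring, a ≠ 0 ∧ a⁻¹ ∉ R.toSubring ∧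
      IsLocalizationOf (blowupChart R a) S := by
  constructor
  · rintro ⟨hle, a, ha, a0, P, hP, rfl⟩
    have a0' : (a : Fn) ≠ 0 := fun h => a0 (Subtype.ext h)
    exact ⟨hle, a, a.2, a0', ((mem_maximalIdeal_iff a).1 ha).resolve_left a0',
      isLocalizationOf_ofPrime _ _⟩
  · rintro ⟨hle, a, ha, a0, hai, hloc⟩
    exact ⟨hle, ⟨a, ha⟩, (mem_maximalIdeal_iff _).2 (Or.inr hai),
      fun h => a0 (congrArg Subtype.val h), hloc.exists_eq_ofPrime⟩

/-! ### Smooth separated models and their stability under blowup -/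

/-- The local rings are localizations of polynomial rings in two variables, their localizations
are again local rings of the surface, and the surface is separated. -/
structure IsSmoothModel (X : Set (LocalSubring Fn)) : Prop where
  exists_chart : ∀ R ∈ X, ∃ u v, GenerateFn u v ∧ IsLocalizationOf (coordRing u v) R
  mem_of_isLocalizationOf : ∀ R ∈ X, ∀ S, IsLocalizationOf R.toSubring S → S ∈ X
  separated : ∀ R ∈ X, ∀ S ∈ X, ∀ V : LocalSubring Fn, R ≤ V → S ≤ V → R = S

theorem generateFn_coord : GenerateFn (coord 0) (coord 1) := by
  rw [GenerateFn, ← top_le_iff]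
  intro z _
  obtain ⟨a, b, -, rfl⟩ := IsFractionRing.div_surjective Poly z
  have h : ∀ p : Poly, algebraMap Poly Fn p ∈ IntermediateField.adjoin ℂ {coord 0, coord 1} := by
    intro p
    induction p using MvPolynomial.induction_on with
    | C c =>
      have : algebraMap Poly Fn (MvPolynomial.C c) = algebraMap ℂ Fn c :=
        (IsScalarTower.algebraMap_apply ℂ Poly Fn c).symm
      rw [this]
      exact IntermediateField.algebraMap_mem _ c
    | add p q hp hq => rw [map_add]; exact add_mem hp hq
    | mul_X p i hp =>
      rw [map_mul]
      refine mul_mem hp (IntermediateField.subset_adjoin _ _ ?_)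
      fin_cases i
      exacts [Or.inl rfl, Or.inr rfl]
  exact div_mem (h a) (h b)

theorem chartRing_eq (ε : Fin 2 → Bool) :
    chartRing ε = coordRing (if ε 0 then coord 0 else (coord 0)⁻¹)
      (if ε 1 then coord 1 else (coord 1)⁻¹) := by
  rw [chartRing, coordRing]
  congr 2
  ext z
  rw [Set.mem_range, Fin.exists_fin_two, Set.mem_insert_iff, Set.mem_singleton_iff,
    eq_comm, @eq_comm _ _ z]

theorem generateFn_chart (ε : Fin 2 → Bool) :
    GenerateFn (if ε 0 then coord 0 else (coord 0)⁻¹) (if ε 1 then coord 1 else (coord 1)⁻¹) := by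
  refine generateFn_coord.of_mem ?_ ?_
  · have h := IntermediateField.subset_adjoin ℂ
      {if ε 0 then coord 0 else (coord 0)⁻¹, if ε 1 then coord 1 else (coord 1)⁻¹} (Or.inl rfl)
    split_ifs at h ⊢
    · exact h
    · exact h
    all_goals exact inv_mem_iff.1 h
  · have h := IntermediateField.subset_adjoin ℂ
      {if ε 0 then coord 0 else (coord 0)⁻¹, if ε 1 then coord 1 else (coord 1)⁻¹} (Or.inr rfl)
    split_ifs at h ⊢
    · exact h
    · exact inv_mem_iff.1 h
    · exact h
    · exact inv_mem_iff.1 h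

theorem mem_p1p1Points_iff {R : LocalSubring Fn} :
    R ∈ p1p1Points ↔ ∃ ε, IsLocalizationOf (chartRing ε) R := by
  constructor
  · rintro ⟨ε, P, hP, rfl⟩
    exact ⟨ε, isLocalizationOf_ofPrime _ _⟩
  · rintro ⟨ε, h⟩
    exact ⟨ε, h.exists_eq_ofPrime⟩

/-- If `R` contains a coordinate and `S` its inverse, both lie in `V`. The coordinate is then a unit
of `V`, hence of `R` by domination. -/
theorem chartRing_le_of_le {ε ε' : Fin 2 → Bool} {R S V : LocalSubring Fn}
    (hR : IsLocalizationOf (chartRing ε) R) (hS : IsLocalizationOf (chartRing ε') S)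
    (hRV : R ≤ V) (hSV : S ≤ V) : chartRing ε' ≤ R.toSubring := by
  have hmem : ∀ (ε : Fin 2 → Bool) i, (if ε i then coord i else (coord i)⁻¹) ∈ chartRing ε :=
    fun ε i => Algebra.subset_adjoin ⟨i, rfl⟩
  have key : ∀ i, (if ε' i then coord i else (coord i)⁻¹) ∈ R.toSubring := by
    intro i
    have h1 := hR.1 (hmem ε i)
    have h2 := hSV.1 (hS.1 (hmem ε' i))
    have hl := (localSubring_le_iff.1 hRV).2 _ h1
    revert h1 h2 hl
    cases ε i <;> cases ε' i <;> simp +contextual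
  rw [chartRing_eq ε']
  refine coordRing_le (fun c => hR.1 ?_) (key 0) (key 1)
  rw [chartRing_eq]
  exact algebraMap_mem_coordRing _ _ c

theorem isSmoothModel_p1p1Points : IsSmoothModel p1p1Points where
  exists_chart R hR := by
    obtain ⟨ε, h⟩ := mem_p1p1Points_iff.1 hR
    rw [chartRing_eq] at h
    exact ⟨_, _, generateFn_chart ε, h⟩
  mem_of_isLocalizationOf R hR S hS := by
    obtain ⟨ε, h⟩ := mem_p1p1Points_iff.1 hR
    exact mem_p1p1Points_iff.2 ⟨ε, h.trans hS⟩
  separated R hR S hS V hRV hSV := by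
    obtain ⟨ε, h⟩ := mem_p1p1Points_iff.1 hR
    obtain ⟨ε', h'⟩ := mem_p1p1Points_iff.1 hS
    exact LocalSubring.toSubring_injective (le_antisymm
      (h.toSubring_le (chartRing_le_of_le h' h hSV hRV) hRV.1 hSV)
      (h'.toSubring_le (chartRing_le_of_le h h' hRV hSV) hSV.1 hRV))

theorem IsClosedPoint.exists_sub_nonunit {R : LocalSubring Fn} (hc : IsClosedPoint R) {f : Fn}
    (hf : f ∈ R.toSubring) : ∃ c : ℂ, f - algebraMap ℂ Fn c ∈ R.toSubring ∧
      (f - algebraMap ℂ Fn c = 0 ∨ (f - algebraMap ℂ Fn c)⁻¹ ∉ R.toSubring) := by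
  obtain ⟨c, m, hm, h⟩ := hc ⟨f, hf⟩
  have : f - algebraMap ℂ Fn c = m := by
    rw [sub_eq_iff_eq_add']; exact h
  refine ⟨c, ?_⟩
  rw [this]
  exact ⟨m.2, (mem_maximalIdeal_iff m).1 hm⟩

/-- The only specialization of a closed point is the point itself. -/
theorem IsClosedPoint.eq_of_isLocalizationOf {R S : LocalSubring Fn} (hc : IsClosedPoint R)
    (hS : ∀ c : ℂ, algebraMap ℂ Fn c ∈ S.toSubring) (h : IsLocalizationOf S.toSubring R) :
    R = S := by
  refine h.eq_of_le le_rfl (localSubring_le_iff.2 ⟨h.1, fun g hg hgi => ?_⟩)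
  by_contra hgS
  have g0 : g ≠ 0 := fun h0 => hgS (by simp [h0])
  obtain ⟨c, hm, hm'⟩ := hc.exists_sub_nonunit (h.1 hg)
  have hmS : g - algebraMap ℂ Fn c ∈ S.toSubring := sub_mem hg (hS c)
  by_cases c0 : c = 0
  · subst c0
    rw [map_zero, sub_zero] at hm'
    exact hm'.elim g0 fun h => h hgi
  -- The constant `c` is a unit of `S` and `g` is not, so `g - c` is a unit of `S`, hence of `R`.
  -- This contradicts the choice of `c`.
  · have c0' : algebraMap ℂ Fn c ≠ 0 := by simpa using c0
    have hsum : g + -(g - algebraMap ℂ Fn c) = algebraMap ℂ Fn c := by ring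
    rcases inv_mem_of_add_inv_mem hg (neg_mem hmS) (by rwa [hsum])
      (by rw [hsum, ← map_inv₀]; exact hS _) with h1 | h1
    · exact hgS h1.2
    · have h2 : (g - algebraMap ℂ Fn c)⁻¹ ∈ S.toSubring := by
        have := neg_mem h1.2
        rwa [neg_inv, neg_neg] at this
      exact hm'.elim (fun h => h1.1 (by rw [h, neg_zero])) fun h' => h' (h.1 h2)

theorem blowupChart_exists_mul_pow_mem {R : LocalSubring Fn} {a : Fn} (ha : a ∈ R.toSubring)
    (a0 : a ≠ 0) {z : Fn} (hz : z ∈ blowupChart R a) :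
    ∃ k : ℕ, z * a ^ k ∈ R.toSubring := by
  induction hz using Subring.closure_induction with
  | mem x hx =>
    rcases hx with hx | ⟨m, -, rfl⟩
    · exact ⟨0, by simpa using hx⟩
    · exact ⟨1, by rw [pow_one, div_mul_cancel₀ _ a0]; exact m.2⟩
  | zero => exact ⟨0, by simp⟩
  | one => exact ⟨0, by simp⟩
  | add x y _ _ hx hy =>
    obtain ⟨k, hk⟩ := hx
    obtain ⟨l, hl⟩ := hy
    refine ⟨k + l, ?_⟩
    have : (x + y) * a ^ (k + l) = (x * a ^ k) * a ^ l + (y * a ^ l) * a ^ k := by ring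
    rw [this]
    exact add_mem (mul_mem hk (pow_mem ha l)) (mul_mem hl (pow_mem ha k))
  | neg x _ hx =>
    obtain ⟨k, hk⟩ := hx
    exact ⟨k, by rw [neg_mul]; exact neg_mem hk⟩
  | mul x y _ _ hx hy =>
    obtain ⟨k, hk⟩ := hx
    obtain ⟨l, hl⟩ := hy
    refine ⟨k + l, ?_⟩
    have : (x * y) * a ^ (k + l) = (x * a ^ k) * (y * a ^ l) := by ring
    rw [this]
    exact mul_mem hk hl

/-- Away from the exceptional divisor, localizations of the chart of a blowup are localizations of
the blown up ring. -/
theorem isLocalizationOf_of_inv_mem {R S : LocalSubring Fn} {a : Fn} (ha : a ∈ R.toSubring)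
    (a0 : a ≠ 0) (h : IsLocalizationOf (blowupChart R a) S) (hai : a⁻¹ ∈ S.toSubring) :
    IsLocalizationOf R.toSubring S := by
  refine ⟨fun x hx => h.1 (mem_blowupChart_left hx), fun z hz => ?_⟩
  obtain ⟨f, hf, g, hg, g0, gi, rfl⟩ := h.2 z hz
  obtain ⟨k, hk⟩ := blowupChart_exists_mul_pow_mem ha a0 hf
  obtain ⟨l, hl⟩ := blowupChart_exists_mul_pow_mem ha a0 hg
  refine ⟨(f * a ^ k) * a ^ l, mul_mem hk (pow_mem ha l), (g * a ^ l) * a ^ k,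
    mul_mem hl (pow_mem ha k), ?_, ?_, ?_⟩
  · exact mul_ne_zero (mul_ne_zero g0 (pow_ne_zero _ a0)) (pow_ne_zero _ a0)
  · rw [mul_inv, mul_inv, ← inv_pow, ← inv_pow]
    exact mul_mem (mul_mem gi (pow_mem hai l)) (pow_mem hai k)
  · field_simp

/-- If `u` generates the ideal `𝔪 S` of the exceptional divisor, then `u, v / u` are coordinates
at `S`. -/
theorem isLocalizationOf_coordRing_div {u v a : Fn} {R S : LocalSubring Fn}
    (hR : IsLocalizationOf (coordRing u v) R) (u0 : u ≠ 0) (hu : u⁻¹ ∉ R.toSubring)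
    (hv : v = 0 ∨ v⁻¹ ∉ R.toSubring) (hRS : R ≤ S) (ha : a ∈ R.toSubring) (a0 : a ≠ 0)
    (hai : a⁻¹ ∉ R.toSubring) (hS : IsLocalizationOf (blowupChart R a) S)
    (hua : (u / a)⁻¹ ∈ S.toSubring) : IsLocalizationOf (coordRing u (v / u)) S := by
  have hur := hR.1 (left_mem_coordRing u v)
  have hvr := hR.1 (right_mem_coordRing u v)
  have hvu : v / u ∈ S.toSubring := by
    have : v / u = (v / a) * (u / a)⁻¹ := by field_simp
    rw [this]
    exact mul_mem (hS.1 (div_mem_blowupChart hvr hv)) hua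
  have hC : ∀ c, algebraMap ℂ Fn c ∈ S.toSubring := fun c =>
    hRS.1 (hR.1 (algebraMap_mem_coordRing u v c))
  -- Let `T` be the center of `S` on `ℂ[u, v / u]`. The ideal `𝔪` is generated by `u` and `v`, so `𝔪
  -- / u ⊆ T`; as `u / a` is a unit of `T`, the whole blowup chart lies in `T`, which forces `S =
  -- T`.
  obtain ⟨P, hP, hTS⟩ := exists_ofPrime_le (coordRing_le hC (hRS.1 hur) hvu)
  have hT := isLocalizationOf_ofPrime (coordRing u (v / u)) P
  set T := LocalSubring.ofPrime (coordRing u (v / u)) P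
  have huT : u ∈ T.toSubring := hT.1 (left_mem_coordRing _ _)
  have hvuT : v / u ∈ T.toSubring := hT.1 (right_mem_coordRing _ _)
  have hvT : v ∈ T.toSubring := by
    rw [← mul_div_cancel₀ v u0]; exact mul_mem huT hvuT
  have hRT : R.toSubring ≤ T.toSubring :=
    hR.toSubring_le (coordRing_le (fun c => hT.1 (algebraMap_mem_coordRing _ _ c)) huT hvT)
      hRS.1 hTS
  have hdiv : ∀ m ∈ R.toSubring, (m = 0 ∨ m⁻¹ ∉ R.toSubring) → m / u ∈ T.toSubring := by
    intro m hm hm'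
    obtain ⟨α, hα, β, hβ, rfl⟩ := exists_eq_of_nonunit hR (Or.inr hu) hv hm hm'
    have : (α * u + β * v) / u = α + β * (v / u) := by field_simp
    rw [this]
    exact add_mem (hRT hα) (mul_mem (hRT hβ) hvuT)
  have hau : u / a ∈ T.toSubring := by
    have h := (localSubring_le_iff.1 hTS).2 _ (hdiv a ha (Or.inr hai))
    rw [inv_div] at h
    exact h (hS.1 (div_mem_blowupChart hur (Or.inr hu)))
  have : S = T := by
    refine hS.eq_of_le (blowupChart_le hRT fun m hm hm' => ?_) hTS
    have : m / a = (m / u) * (u / a) := by field_simp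
    rw [this]
    exact mul_mem (hdiv m hm hm') hau
  rw [this]
  exact hT

/-- After a translation the blown-up point is the origin, and `𝔪 = (s, t)`. Dividing `a = α s + β t`
by `a` writes `1` as a sum in the local ring `S`, so `s / a` or `t / a` is a unit there. Accordingly
`(s, t / s)` or `(t, s / t)` are coordinates at `S`. -/
theorem exists_chart_of_mem_exceptionalPoints {u v : Fn} {R S : LocalSubring Fn}
    (huv : GenerateFn u v) (hR : IsLocalizationOf (coordRing u v) R) (hc : IsClosedPoint R)
    (hS : S ∈ exceptionalPoints R) :
    ∃ u' v', GenerateFn u' v' ∧ IsLocalizationOf (coordRing u' v') S := by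
  obtain ⟨hRS, a, ha, a0, hai, hloc⟩ := mem_exceptionalPoints_iff.1 hS
  obtain ⟨c, hcu, hcu'⟩ := hc.exists_sub_nonunit (hR.1 (left_mem_coordRing u v))
  obtain ⟨d, hdv, hdv'⟩ := hc.exists_sub_nonunit (hR.1 (right_mem_coordRing u v))
  set s := u - algebraMap ℂ Fn c with hs
  set t := v - algebraMap ℂ Fn d with ht
  have hst : GenerateFn s t := by
    refine huv.of_mem ?_ ?_
    · have : u = s + algebraMap ℂ Fn c := by rw [hs]; ring
      rw [this]
      exact add_mem (IntermediateField.subset_adjoin _ _ (by simp))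
        (IntermediateField.algebraMap_mem _ _)
    · have : v = t + algebraMap ℂ Fn d := by rw [ht]; ring
      rw [this]
      exact add_mem (IntermediateField.subset_adjoin _ _ (by simp))
        (IntermediateField.algebraMap_mem _ _)
  have hR' : IsLocalizationOf (coordRing s t) R := by
    have : coordRing s t = coordRing u v := by
      apply le_antisymm
      · exact coordRing_le (algebraMap_mem_coordRing _ _)
          (sub_mem (left_mem_coordRing _ _) (algebraMap_mem_coordRing _ _ _))
          (sub_mem (right_mem_coordRing _ _) (algebraMap_mem_coordRing _ _ _))
      · refine coordRing_le (algebraMap_mem_coordRing _ _) ?_ ?_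
        · have : u = s + algebraMap ℂ Fn c := by rw [hs]; ring
          rw [this]
          exact add_mem (left_mem_coordRing _ _) (algebraMap_mem_coordRing _ _ _)
        · have : v = t + algebraMap ℂ Fn d := by rw [ht]; ring
          rw [this]
          exact add_mem (right_mem_coordRing _ _) (algebraMap_mem_coordRing _ _ _)
    rwa [this]
  have gen : ∀ {u v : Fn}, GenerateFn u v → GenerateFn u (v / u) := by
    intro u v h
    have hu : u ∈ IntermediateField.adjoin ℂ {u, v / u} :=
      IntermediateField.subset_adjoin _ _ (by simp)
    refine h.of_mem hu ?_
    have : v = u * (v / u) := (mul_div_cancel₀ v h.left_ne_zero).symm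
    have hm := mul_mem hu (IntermediateField.subset_adjoin ℂ {u, v / u} (Or.inr rfl))
    rwa [← this] at hm
  have s0 := hst.left_ne_zero
  have t0 := hst.symm.left_ne_zero
  obtain ⟨α, hα, β, hβ, hab⟩ := exists_eq_of_nonunit hR' hcu' hdv' ha (Or.inr hai)
  have hone : α * (s / a) + β * (t / a) = 1 := by
    field_simp
    exact hab.symm
  have hsa : s / a ∈ S.toSubring := hloc.1 (div_mem_blowupChart hcu hcu')
  have hta : t / a ∈ S.toSubring := hloc.1 (div_mem_blowupChart hdv hdv')
  have inv_right : ∀ {x y : Fn}, x ∈ S.toSubring → x * y ≠ 0 → (x * y)⁻¹ ∈ S.toSubring →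
      y⁻¹ ∈ S.toSubring := by
    intro x y hx h0 hi
    have x0 := left_ne_zero_of_mul h0
    have y0 := right_ne_zero_of_mul h0
    have : y⁻¹ = x * (x * y)⁻¹ := by field_simp
    rw [this]
    exact mul_mem hx hi
  rcases inv_mem_of_add_inv_mem (mul_mem (hRS.1 hα) hsa) (mul_mem (hRS.1 hβ) hta)
    (by rw [hone]; exact one_ne_zero) (by rw [hone, inv_one]; exact one_mem _) with h | h
  · exact ⟨s, t / s, gen hst, isLocalizationOf_coordRing_div hR' s0 (hcu'.resolve_left s0) hdv' hRS
      ha a0 hai hloc (inv_right (hRS.1 hα) h.1 h.2)⟩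
  · rw [coordRing_comm] at hR'
    exact ⟨t, s / t, gen hst.symm, isLocalizationOf_coordRing_div hR' t0 (hdv'.resolve_left t0) hcu'
      hRS ha a0 hai hloc (inv_right (hRS.1 hβ) h.1 h.2)⟩

/-- Charts for `a` and `b` are glued along `b / a`: it lies in `S`, its inverse lies in `T`, and
both lie in `V`, so domination puts `b / a` in `T`. -/
theorem exceptionalPoints_toSubring_le {R S T V : LocalSubring Fn} (hS : S ∈ exceptionalPoints R)
    (hT : T ∈ exceptionalPoints R) (hSV : S ≤ V) (hTV : T ≤ V) : S.toSubring ≤ T.toSubring := by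
  obtain ⟨hRS, a, ha, a0, hai, hS⟩ := mem_exceptionalPoints_iff.1 hS
  obtain ⟨hRT, b, hb, b0, hbi, hT⟩ := mem_exceptionalPoints_iff.1 hT
  refine hS.toSubring_le (blowupChart_le hRT.1 fun m hm hm' => ?_) hSV.1 hTV
  have hba : b / a ∈ T.toSubring := by
    have h := (localSubring_le_iff.1 hTV).2 _ (hT.1 (div_mem_blowupChart ha (Or.inr hai)))
    rw [inv_div] at h
    exact h (hSV.1 (hS.1 (div_mem_blowupChart hb (Or.inr hbi))))
  have : m / a = (m / b) * (b / a) := by field_simp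
  rw [this]
  exact mul_mem (hT.1 (div_mem_blowupChart hm hm')) hba

theorem IsSmoothModel.algebraMap_mem {X : Set (LocalSubring Fn)} (hX : IsSmoothModel X)
    {R : LocalSubring Fn} (hR : R ∈ X) (c : ℂ) : algebraMap ℂ Fn c ∈ R.toSubring := by
  obtain ⟨u, v, -, h⟩ := hX.exists_chart R hR
  exact h.1 (algebraMap_mem_coordRing u v c)

theorem IsSmoothModel.blowupPoints {X : Set (LocalSubring Fn)} (hX : IsSmoothModel X)
    {R : LocalSubring Fn} (hR : R ∈ X) (hc : IsClosedPoint R) :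
    IsSmoothModel (blowupPoints X R) where
  exists_chart S hS := by
    rcases hS with hS | hS
    · exact hX.exists_chart S hS.1
    · obtain ⟨u, v, huv, h⟩ := hX.exists_chart R hR
      exact exists_chart_of_mem_exceptionalPoints huv h hc hS
  mem_of_isLocalizationOf S hS T hT := by
    rcases hS with ⟨hSX, hSR⟩ | hS
    · refine Or.inl ⟨hX.mem_of_isLocalizationOf S hSX T hT, ?_⟩
      rintro rfl
      exact hSR (hc.eq_of_isLocalizationOf (hX.algebraMap_mem hSX) hT).symm
    · obtain ⟨hRS, a, ha, a0, hai, hloc⟩ := mem_exceptionalPoints_iff.1 hS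
      have hloc' := hloc.trans hT
      -- If `a` is a unit of `T`, then `T` is off the exceptional curve and is a localization of
      -- `R`. Otherwise `T` still dominates `R`: a nonunit `x` of `R` invertible in `T` would give
      -- `a⁻¹ = x⁻¹ (x / a) ∈ T`.
      by_cases haT : a⁻¹ ∈ T.toSubring
      · refine Or.inl ⟨hX.mem_of_isLocalizationOf R hR T
          (isLocalizationOf_of_inv_mem ha a0 hloc' haT), ?_⟩
        rintro rfl
        exact hai haT
      · refine Or.inr (mem_exceptionalPoints_iff.2 ⟨localSubring_le_iff.2
          ⟨hRS.1.trans hT.1, fun x hx hxi => ?_⟩, a, ha, a0, hai, hloc'⟩)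
        by_contra hxR
        have x0 : x ≠ 0 := fun h0 => hxR (by simp [h0])
        apply haT
        have : a⁻¹ = x⁻¹ * (x / a) := by field_simp
        rw [this]
        exact mul_mem hxi (hloc'.1 (div_mem_blowupChart hx (Or.inr hxR)))
  separated S hS T hT V hSV hTV := by
    rcases hS with ⟨hSX, hSR⟩ | hS <;> rcases hT with ⟨hTX, hTR⟩ | hT
    · exact hX.separated S hSX T hTX V hSV hTV
    -- A point over `R` dominates `R`, so in the mixed cases separatedness of `X` would identify the
    -- kept point with `R`.
    · exact absurd (hX.separated S hSX R hR V hSV (hT.1.trans hTV)) hSR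
    · exact absurd (hX.separated T hTX R hR V hTV (hS.1.trans hSV)) hTR
    · exact LocalSubring.toSubring_injective (le_antisymm
        (exceptionalPoints_toSubring_le hS hT hSV hTV) (exceptionalPoints_toSubring_le hT hS hTV hSV))

theorem IsIteratedBlowup.isSmoothModel {X : Set (LocalSubring Fn)} (hX : IsIteratedBlowup X) :
    IsSmoothModel X := by
  induction hX with
  | base => exact isSmoothModel_p1p1Points
  | blowup X R _ hR hc ih => exact ih.blowupPoints hR hc

/-! ### Curves of the affine plane -/

theorem coe_generateFn_coord_equiv (p : Poly) : (generateFn_coord.equiv p : Fn) = p.toFn := by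
  have h : ((generateFn_coord.equiv p : coordRing (coord 0) (coord 1)) : Fn) =
      MvPolynomial.aeval ![coord 0, coord 1] p :=
    generateFn_coord.algebraicIndependent.algebraMap_aevalEquiv p
  rw [h]
  have : (MvPolynomial.aeval ![coord 0, coord 1] : Poly →ₐ[ℂ] Fn) =
      IsScalarTower.toAlgHom ℂ Poly Fn := by
    apply MvPolynomial.algHom_ext
    intro i
    rw [MvPolynomial.aeval_X]
    fin_cases i <;> rfl
  rw [this]
  rfl

theorem toFn_ne_zero {p : Poly} (h : p ≠ 0) : p.toFn ≠ 0 := by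
  simpa using h

/-- The elements of the local ring of the affine plane along the curve `q = 0`. -/
def IsRingAlong (q : Poly) (S : LocalSubring Fn) : Prop :=
  ∀ z : Fn, z ∈ S.toSubring ↔ ∃ a b : Poly, ¬ q ∣ b ∧ z = a.toFn / b.toFn

theorem exists_isRingAlong {q : Poly} (hq : Irreducible q) :
    ∃ S : LocalSubring Fn, IsRingAlong q S ∧ IsDiscreteValuationRing S.toSubring ∧
      IsLocalizationOf (coordRing (coord 0) (coord 1)) S := by
  let e := generateFn_coord.equiv
  have hq' : Prime (e q) := (MulEquiv.prime_iff e).2 hq.prime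
  have hP : (Ideal.span {e q}).IsPrime := (Ideal.span_singleton_prime hq'.ne_zero).2 hq'
  have := generateFn_coord.isNoetherianRing
  refine ⟨LocalSubring.ofPrime _ (Ideal.span {e q}), fun z => ?_, isDVR_ofPrime_span hq',
    isLocalizationOf_ofPrime _ _⟩
  rw [mem_ofPrime]
  constructor
  · rintro ⟨a, b, hb, rfl⟩
    refine ⟨e.symm a, e.symm b, fun h => hb (Ideal.mem_span_singleton.2 ?_), ?_⟩
    · simpa using map_dvd e h
    · rw [← coe_generateFn_coord_equiv, ← coe_generateFn_coord_equiv]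
      simp [e]
  · rintro ⟨a, b, hb, rfl⟩
    refine ⟨e a, e b, fun h => hb ?_, ?_⟩
    · simpa using map_dvd e.symm (Ideal.mem_span_singleton.1 h)
    · rw [← coe_generateFn_coord_equiv, ← coe_generateFn_coord_equiv]

theorem IsRingAlong.inv_mem {q p : Poly} {S : LocalSubring Fn} (hS : IsRingAlong q S)
    (h : ¬ q ∣ p) : (p.toFn)⁻¹ ∈ S.toSubring :=
  (hS _).2 ⟨1, p, h, by simp⟩

theorem IsRingAlong.toFn_mem {q : Poly} {S : LocalSubring Fn} (hS : IsRingAlong q S)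
    (hq : Irreducible q) (p : Poly) : p.toFn ∈ S.toSubring :=
  (hS _).2 ⟨p, 1, fun h => hq.not_isUnit (isUnit_of_dvd_one h), by simp⟩

theorem IsRingAlong.not_dvd_of_div_mem {q a b : Poly} {S : LocalSubring Fn}
    (hS : IsRingAlong q S) (hq : Irreducible q) (b0 : b ≠ 0) (hab : ¬ q ∣ a)
    (h : a.toFn / b.toFn ∈ S.toSubring) : ¬ q ∣ b := by
  obtain ⟨c, d, hd, hcd⟩ := (hS _).1 h
  have d0 : d ≠ 0 := by rintro rfl; exact hd (dvd_zero q)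
  rw [div_eq_div_iff (toFn_ne_zero b0) (toFn_ne_zero d0), ← map_mul, ← map_mul] at hcd
  have h1 : a * d = c * b := IsFractionRing.injective Poly Fn hcd
  intro hb
  have h2 : q ∣ a * d := h1 ▸ hb.mul_left c
  exact (hq.prime.dvd_or_dvd h2).elim hab hd

theorem irreducible_X_sub_C (i : Fin 2) (c : ℂ) :
    Irreducible (MvPolynomial.X i - MvPolynomial.C c : Poly) := by
  classical
  have h1 : (MvPolynomial.X i - MvPolynomial.C c : Poly).coeff (Finsupp.single i 1) = 1 := by
    rw [MvPolynomial.coeff_sub, MvPolynomial.coeff_X, if_pos rfl, MvPolynomial.coeff_C,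
      if_neg, sub_zero]
    intro h
    simpa using DFunLike.congr_fun h i
  refine MvPolynomial.irreducible_of_totalDegree_eq_one (le_antisymm ?_ ?_) fun x hx => ?_
  · refine (MvPolynomial.totalDegree_sub _ _).trans ?_
    simp
  · have := MvPolynomial.le_totalDegree (p := (MvPolynomial.X i - MvPolynomial.C c : Poly))
      (s := Finsupp.single i 1) (MvPolynomial.mem_support_iff.2 (by rw [h1]; exact one_ne_zero))
    simpa using this
  · exact isUnit_of_dvd_one (h1 ▸ hx (Finsupp.single i 1))

/-- With residue field `ℂ`, both coordinates would be constant along the curve, so `q` would divide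
some `x - c` and some `y - d`. -/
theorem IsRingAlong.not_isClosedPoint {q : Poly} {S : LocalSubring Fn} (hS : IsRingAlong q S)
    (hq : Irreducible q) : ¬ IsClosedPoint S := by
  intro hc
  have key : ∀ i, ∃ c : ℂ, q ∣ MvPolynomial.X i - MvPolynomial.C c := by
    intro i
    obtain ⟨c, -, h⟩ := hc.exists_sub_nonunit (hS.toFn_mem hq (MvPolynomial.X i))
    refine ⟨c, ?_⟩
    by_contra hd
    have heq : Poly.toFn (MvPolynomial.X i - MvPolynomial.C c) =
        Poly.toFn (MvPolynomial.X i) - algebraMap ℂ Fn c := by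
      rw [Poly.toFn, map_sub, IsScalarTower.algebraMap_apply ℂ Poly Fn c]
      rfl
    rw [← heq] at h
    rcases h with h | h
    · refine toFn_ne_zero (fun h0 => hd ?_) h
      rw [h0]; exact dvd_zero q
    · exact h (hS.inv_mem hd)
  obtain ⟨c, hc⟩ := key 0
  obtain ⟨d, hd⟩ := key 1
  have h1 : (MvPolynomial.X 0 - MvPolynomial.C c : Poly) ∣ MvPolynomial.X 1 - MvPolynomial.C d :=
    ((hq.associated_of_dvd (irreducible_X_sub_C 0 c) hc).symm.dvd).trans hd
  -- At `(c, d + 1)` the divisor `x - c` vanishes while `y - d` takes the value `1`.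
  have h2 := map_dvd (MvPolynomial.eval ![c, d + 1]) h1
  simp at h2

/-- Each blowup removes only a closed point, so the local ring along an affine curve survives. -/
theorem IsRingAlong.mem_of_isIteratedBlowup {q : Poly} {S : LocalSubring Fn}
    (hS : IsRingAlong q S) (hq : Irreducible q)
    (hloc : IsLocalizationOf (coordRing (coord 0) (coord 1)) S) {X : Set (LocalSubring Fn)}
    (hX : IsIteratedBlowup X) : S ∈ X := by
  induction hX with
  | base => exact mem_p1p1Points_iff.2 ⟨fun _ => true, by rw [chartRing_eq]; exact hloc⟩
  | blowup X R _ hR hc ih =>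
    refine Or.inl ⟨ih, ?_⟩
    rintro rfl
    exact hS.not_isClosedPoint hq hc

/-- The strict transform of an irreducible curve in the affine plane. -/
theorem exists_primeDivisor (X : Surface) {q : Poly} (hq : Irreducible q) :
    ∃ E : PrimeDivisor X, IsRingAlong q E.ring := by
  obtain ⟨S, h, hdvr, hloc⟩ := exists_isRingAlong hq
  exact ⟨⟨S, h.mem_of_isIteratedBlowup hq hloc X.isIteratedBlowup, hdvr⟩, h⟩

/-- An irreducible factor of the numerator or denominator of the reduced fraction would be a zero or
a pole, so both are units of `ℂ[x, y]`. -/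
theorem exists_eq_algebraMap {F : Fn} (F0 : F ≠ 0)
    (h : ∀ q : Poly, Irreducible q → ∃ S : LocalSubring Fn, IsRingAlong q S ∧
      F ∈ S.toSubring ∧ F⁻¹ ∈ S.toSubring) :
    ∃ c : ℂ, c ≠ 0 ∧ F = algebraMap ℂ Fn c := by
  obtain ⟨a, b, hab, rfl⟩ := IsFractionRing.exists_reduced_fraction (A := Poly) F
  have b0 : (b : Poly) ≠ 0 := nonZeroDivisors.ne_zero b.2
  rw [IsFractionRing.mk'_eq_div] at h F0 ⊢
  have a0 : a ≠ 0 := by rintro rfl; simp at F0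
  have ha : IsUnit a := by
    by_contra hu
    obtain ⟨q, hq, hqa⟩ := WfDvdMonoid.exists_irreducible_factor hu a0
    obtain ⟨S, hS, -, h2⟩ := h q hq
    rw [inv_div] at h2
    exact hS.not_dvd_of_div_mem hq a0 (fun hqb => hq.not_isUnit (hab hqa hqb)) h2 hqa
  have hb : IsUnit (b : Poly) := by
    by_contra hu
    obtain ⟨q, hq, hqb⟩ := WfDvdMonoid.exists_irreducible_factor hu b0
    obtain ⟨S, hS, h1, -⟩ := h q hq
    exact hS.not_dvd_of_div_mem hq b0 (fun hqa => hq.not_isUnit (hab hqa hqb)) h1 hqb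
  rw [MvPolynomial.isUnit_iff_eq_C_of_isReduced] at ha hb
  obtain ⟨c, hc, hac⟩ := ha
  obtain ⟨d, hd, hbd⟩ := hb
  refine ⟨c / d, div_ne_zero hc.ne_zero hd.ne_zero, ?_⟩
  rw [map_div₀, hac, hbd, IsScalarTower.algebraMap_apply ℂ Poly Fn c,
    IsScalarTower.algebraMap_apply ℂ Poly Fn d]
  rfl

/-! ### Orders along prime divisors -/

section Order

variable {X : Surface} {E : PrimeDivisor X}

theorem HasOrd.ne_zero {f : Fn} {n : ℤ} (h : HasOrd E f n) : f ≠ 0 := by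
  obtain ⟨ϖ, u, hϖ, hu, rfl⟩ := h
  exact mul_ne_zero ((isUnit_iff_inv_mem u).1 hu).1
    (zpow_ne_zero _ fun h => hϖ.ne_zero (Subtype.ext h))

theorem hasOrd_zero_iff {f : Fn} :
    HasOrd E f 0 ↔ f ≠ 0 ∧ f ∈ E.ring.toSubring ∧ f⁻¹ ∈ E.ring.toSubring := by
  have := E.isDVR
  constructor
  · intro h
    have f0 := h.ne_zero
    obtain ⟨ϖ, u, hϖ, hu, rfl⟩ := h
    rw [zpow_zero, mul_one] at f0 ⊢
    exact ⟨f0, u.2, ((isUnit_iff_inv_mem u).1 hu).2⟩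
  · rintro ⟨h0, h, hi⟩
    obtain ⟨ϖ, hϖ⟩ := IsDiscreteValuationRing.exists_irreducible E.ring.toSubring
    exact ⟨ϖ, ⟨f, h⟩, hϖ, (isUnit_iff_inv_mem _).2 ⟨h0, hi⟩, by simp⟩

/-- Uniformizers of a discrete valuation ring are associated, so orders of several functions can be
read off with a common one. -/
theorem HasOrd.exists_eq {f : Fn} {n : ℤ} (h : HasOrd E f n) {ϖ : E.ring.toSubring}
    (hϖ : Irreducible ϖ) : ∃ u : E.ring.toSubring, IsUnit u ∧ f = (u : Fn) * (ϖ : Fn) ^ n := by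
  have := E.isDVR
  obtain ⟨ϖ', u, hϖ', hu, rfl⟩ := h
  obtain ⟨v, rfl⟩ := IsDiscreteValuationRing.associated_of_irreducible E.ring.toSubring hϖ hϖ'
  refine ⟨u * (v ^ n : (E.ring.toSubring)ˣ), hu.mul (Units.isUnit _), ?_⟩
  have hv : (((v ^ n : (E.ring.toSubring)ˣ) : E.ring.toSubring) : Fn) =
      ((v : E.ring.toSubring) : Fn) ^ n := by
    have := congrArg Units.val (map_zpow (Units.map E.ring.toSubring.subtype.toMonoidHom) v n)
    rw [Units.val_zpow_eq_zpow_val] at this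
    exact this
  rw [Subring.coe_mul, Subring.coe_mul, hv, mul_zpow]
  ring

theorem HasOrd.mul {f g : Fn} {m n : ℤ} (hf : HasOrd E f m) (hg : HasOrd E g n) :
    HasOrd E (f * g) (m + n) := by
  obtain ⟨ϖ, u, hϖ, hu, rfl⟩ := hf
  obtain ⟨v, hv, rfl⟩ := hg.exists_eq hϖ
  have h0 : (ϖ : Fn) ≠ 0 := fun h => hϖ.ne_zero (Subtype.ext h)
  refine ⟨ϖ, u * v, hϖ, hu.mul hv, ?_⟩
  rw [zpow_add₀ h0, Subring.coe_mul]
  ring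

theorem HasOrd.inv {f : Fn} {m : ℤ} (hf : HasOrd E f m) : HasOrd E f⁻¹ (-m) := by
  obtain ⟨ϖ, u, hϖ, hu, rfl⟩ := hf
  have h := (isUnit_iff_inv_mem u).1 hu
  refine ⟨ϖ, ⟨_, h.2⟩, hϖ, (isUnit_iff_inv_mem _).2 ⟨inv_ne_zero h.1, ?_⟩, ?_⟩
  · rw [inv_inv]; exact u.2
  · rw [mul_inv, zpow_neg]

theorem HasOrd.div {f g : Fn} {m n : ℤ} (hf : HasOrd E f m) (hg : HasOrd E g n) :
    HasOrd E (f / g) (m - n) := by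
  rw [div_eq_mul_inv, sub_eq_add_neg]
  exact hf.mul hg.inv

theorem hasOrd_one : HasOrd E 1 0 :=
  hasOrd_zero_iff.2 ⟨one_ne_zero, one_mem _, by rw [inv_one]; exact one_mem _⟩

theorem HasOrd.pow {f : Fn} {m : ℤ} (hf : HasOrd E f m) (k : ℕ) : HasOrd E (f ^ k) (k * m) := by
  induction k with
  | zero => simpa using hasOrd_one
  | succ k ih =>
    rw [pow_succ, Nat.cast_succ, add_mul, one_mul]
    exact ih.mul hf

theorem HasOrd.zpow {f : Fn} {m : ℤ} (hf : HasOrd E f m) (k : ℤ) : HasOrd E (f ^ k) (k * m) := by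
  cases k with
  | ofNat k => simpa using hf.pow k
  | negSucc k =>
    rw [zpow_negSucc, Int.negSucc_eq, neg_mul]
    exact_mod_cast (hf.pow (k + 1)).inv

theorem HasOrd.prod {ι : Type*} {s : Finset ι} {f : ι → Fn} {m : ι → ℤ}
    (h : ∀ i ∈ s, HasOrd E (f i) (m i)) : HasOrd E (∏ i ∈ s, f i) (∑ i ∈ s, m i) := by
  classical
  induction s using Finset.induction_on with
  | empty => simpa using hasOrd_one
  | insert i s hi ih =>
    rw [Finset.prod_insert hi, Finset.sum_insert hi]
    exact (h i (Finset.mem_insert_self i s)).mul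
      (ih fun j hj => h j (Finset.mem_insert_of_mem hj))

theorem IsRingAlong.hasOrd_one {p : Poly} (h : IsRingAlong p E.ring) (hp : Irreducible p) :
    HasOrd E p.toFn 1 := by
  have hpm := h.toFn_mem hp p
  refine ⟨⟨p.toFn, hpm⟩, 1, ⟨?_, ?_⟩, isUnit_one, by simp⟩
  · rw [isUnit_iff_inv_mem]
    rintro ⟨-, hi⟩
    refine h.not_dvd_of_div_mem hp hp.ne_zero (a := 1)
      (fun h1 => hp.not_isUnit (isUnit_of_dvd_one h1)) ?_ dvd_rfl
    simpa using hi
  · rintro ⟨x, hx⟩ ⟨y, hy⟩ hxy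
    have hxy' : p.toFn = x * y := congrArg Subtype.val hxy
    have p0 := toFn_ne_zero hp.ne_zero
    have x0 : x ≠ 0 := by rintro rfl; exact p0 (by simpa using hxy')
    have y0 : y ≠ 0 := by rintro rfl; exact p0 (by simpa using hxy')
    rw [isUnit_iff_inv_mem, isUnit_iff_inv_mem]
    obtain ⟨a, b, hb, rfl⟩ := (h x).1 hx
    obtain ⟨c, d, hd, rfl⟩ := (h y).1 hy
    by_cases ha : p ∣ a
    · by_cases hc : p ∣ c
      -- Cancelling one factor `p` leaves `b * d = p * (a' * c')`, although `p` divides neither `b`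
      -- nor `d`.
      · exfalso
        have b0 : b ≠ 0 := by rintro rfl; exact hb (dvd_zero p)
        have d0 : d ≠ 0 := by rintro rfl; exact hd (dvd_zero p)
        have b0' := toFn_ne_zero b0
        have d0' := toFn_ne_zero d0
        obtain ⟨a', rfl⟩ := ha
        obtain ⟨c', rfl⟩ := hc
        have heq : (b * d).toFn = (p * (a' * c')).toFn := by
          simp only [Poly.toFn, map_mul] at hxy' b0' d0' p0 ⊢
          field_simp at hxy'
          linear_combination hxy'
        have heq' : b * d = p * (a' * c') := IsFractionRing.injective Poly Fn heq
        exact (hp.prime.dvd_or_dvd (Dvd.intro _ heq'.symm)).elim hb hd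
      · right
        refine ⟨y0, ?_⟩
        change (c.toFn / d.toFn)⁻¹ ∈ _
        rw [inv_div]
        exact (h _).2 ⟨d, c, hc, rfl⟩
    · left
      refine ⟨x0, ?_⟩
      change (a.toFn / b.toFn)⁻¹ ∈ _
      rw [inv_div]
      exact (h _).2 ⟨b, a, ha, rfl⟩

theorem PrimeDivisor.ext_ring {E F : PrimeDivisor X} (h : E.ring = F.ring) : E = F := by
  cases E; cases F; cases h; rfl

theorem IsRingAlong.congr {p q : Poly} {S : LocalSubring Fn} (h : IsRingAlong p S)
    (hpq : Associated p q) : IsRingAlong q S := by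
  intro z
  rw [h z]
  simp only [hpq.dvd_iff_dvd_left]

theorem IsRingAlong.eq {q : Poly} {S T : LocalSubring Fn} (hS : IsRingAlong q S)
    (hT : IsRingAlong q T) : S = T :=
  LocalSubring.toSubring_injective (Subring.ext fun z => (hS z).trans (hT z).symm)

/-- Along curves that meet the affine plane, the order of the defining polynomial of a prime
divisor `F` is the multiplicity of `F`. -/
theorem hasOrd_definingPolynomial {q : Poly} (hq : Irreducible q) (hE : IsRingAlong q E.ring)
    {F : PrimeDivisor X} {p : Poly} (hp : IsDefiningPolynomial p (pushforward F)) :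
    HasOrd E p.toFn ((Finsupp.single F 1 : Divisor X) E) := by
  classical
  rcases hp with ⟨C, hC, hpi, hz⟩ | ⟨hC, rfl⟩
  · have hF : F.ring = C.ring := by
      unfold pushforward at hC
      split_ifs at hC with h
      · have := (Finsupp.single_left_inj (one_ne_zero (α := ℤ))).1 hC
        rw [← this]
      · exact absurd hC.symm (by simp)
    have hFp : IsRingAlong p F.ring := by rw [hF]; exact hz
    by_cases hFE : F = E
    · subst hFE
      rw [Finsupp.single_eq_same]
      exact hFp.hasOrd_one hpi
    · rw [Finsupp.single_eq_of_ne (Ne.symm hFE)]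
      refine hasOrd_zero_iff.2 ⟨toFn_ne_zero hpi.ne_zero, hE.toFn_mem hq p,
        hE.inv_mem fun hd => hFE ?_⟩
      have hassoc := hq.associated_of_dvd hpi hd
      exact PrimeDivisor.ext_ring ((hFp.congr hassoc.symm).eq hE)
  -- Since `E` meets the affine chart, `F = E` would give the push-forward a component there, with
  -- coefficient `1`.
  · have hFE : F ≠ E := by
      rintro rfl
      have hmem : F.ring ∈ P1P1.points := by
        obtain ⟨G, hG⟩ := exists_primeDivisor P1P1 hq
        rw [hE.eq hG]
        exact G.mem_points
      have h0 := hC ⟨F.ring, hmem, F.isDVR⟩ fun p => hE.toFn_mem hq p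
      rw [pushforward, dif_pos hmem, Finsupp.single_eq_same] at h0
      exact one_ne_zero h0
    rw [Finsupp.single_eq_of_ne (Ne.symm hFE)]
    simpa [Poly.toFn] using BlowupSurfaces.hasOrd_one

end Order

/-! ### Comparison of functions by orders, and pull-back of local equations -/

/-- Rational functions with the same orders along the curves that meet the affine plane are
proportional. -/
theorem exists_eq_mul_of_hasOrd (X : Surface) {F G : Fn} (D : Divisor X) (hF : F ≠ 0) (hG : G ≠ 0)
    (h : ∀ q : Poly, Irreducible q → ∀ E : PrimeDivisor X, IsRingAlong q E.ring →
      HasOrd E F (D E) ∧ HasOrd E G (D E)) :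
    ∃ c : ℂ, c ≠ 0 ∧ F = algebraMap ℂ Fn c * G := by
  obtain ⟨c, c0, hc⟩ := exists_eq_algebraMap (div_ne_zero hF hG) fun q hq => by
    obtain ⟨E, hE⟩ := exists_primeDivisor X hq
    obtain ⟨h1, h2⟩ := h q hq E hE
    have h3 := h1.div h2
    rw [sub_self, hasOrd_zero_iff] at h3
    exact ⟨E.ring, hE, h3.2⟩
  exact ⟨c, c0, by rw [← hc, div_mul_cancel₀ _ hG]⟩

/-- The local ring induced on the source of a field homomorphism by a local ring of the target. -/
theorem exists_comap_localSubring {K L : Type*} [Field K] [Field L] (f : K →+* L)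
    (V : LocalSubring L) : ∃ W : LocalSubring K, ∀ R : LocalSubring K, R.map f ≤ V → R ≤ W := by
  let A : Subring K := V.toSubring.comap f
  let g : A →+* V.toSubring := f.restrict A V.toSubring fun _ h => h
  have hg : IsLocalHom g := by
    refine ⟨fun x hx => (isUnit_iff_inv_mem x).2 ?_⟩
    obtain ⟨h0, hi⟩ := (isUnit_iff_inv_mem _).1 hx
    refine ⟨fun h => h0 ?_, ?_⟩
    · change f x = 0
      rw [h, map_zero]
    · change f (x : K)⁻¹ ∈ V.toSubring
      rw [map_inv₀]
      exact hi
  have : IsLocalRing A := RingHom.domain_isLocalRing g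
  refine ⟨⟨A⟩, fun R hR => ?_⟩
  obtain ⟨hle, hinv⟩ := localSubring_le_iff.1 hR
  refine localSubring_le_iff.2 ⟨fun x hx => hle ⟨x, hx, rfl⟩, fun x hx hxi => ?_⟩
  obtain ⟨y, hy, hyx⟩ := hinv (f x) ⟨x, hx, rfl⟩ (by rw [← map_inv₀]; exact hxi)
  rw [← map_inv₀] at hyx
  rw [← f.injective hyx]
  exact hy

/-- On a smooth surface, a rational function without poles along the curves through a point is
regular at the point. -/
theorem mem_of_forall_primeDivisor {X : Surface} {R : LocalSubring Fn} (hR : R ∈ X.points) {f : Fn}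
    (h : ∀ E : PrimeDivisor X, R.toSubring ≤ E.ring.toSubring → f ∈ E.ring.toSubring) :
    f ∈ R.toSubring := by
  have hX := X.isIteratedBlowup.isSmoothModel
  obtain ⟨u, v, huv, hloc⟩ := hX.exists_chart R hR
  have := huv.uniqueFactorizationMonoid
  have := huv.isNoetherianRing
  have := huv.isFractionRing
  by_contra hf
  obtain ⟨S, hS, hdvr, hfS⟩ := hloc.exists_isDVR_notMem hf
  exact hfS (h ⟨S, hX.mem_of_isLocalizationOf R hR S hS, hdvr⟩ hS.1)

/-- Two local equations of a divisor at a point differ by a unit. -/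
theorem IsLocalEquation.hasOrd_pullback {X X' : Surface} {φ : DominantRationalMap} {D : Divisor X'}
    {R : LocalSubring Fn} (hR : R ∈ X'.points) {f g : Fn} (hf : IsLocalEquation D R f)
    (hg : IsLocalEquation D R g) (f0 : f ≠ 0) (g0 : g ≠ 0) {E : PrimeDivisor X}
    (hRE : R.map (φ.pullbackFn : Fn →+* Fn) ≤ E.ring) {n : ℤ}
    (h : HasOrd E (φ.pullbackFn g) n) : HasOrd E (φ.pullbackFn f) n := by
  have hunit : ∀ E' : PrimeDivisor X', R.toSubring ≤ E'.ring.toSubring → HasOrd E' (f / g) 0 := by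
    intro E' hE'
    have := (hf E' hE').div (hg E' hE')
    rwa [sub_self] at this
  have h1 : f / g ∈ R.toSubring :=
    mem_of_forall_primeDivisor hR fun E' hE' => (hasOrd_zero_iff.1 (hunit E' hE')).2.1
  have h2 : (f / g)⁻¹ ∈ R.toSubring :=
    mem_of_forall_primeDivisor hR fun E' hE' => (hasOrd_zero_iff.1 (hunit E' hE')).2.2
  have hφ : ∀ x ∈ R.toSubring, φ.pullbackFn x ∈ E.ring.toSubring :=
    fun x hx => hRE.1 ⟨x, hx, rfl⟩
  have h3 : HasOrd E (φ.pullbackFn (f / g)) 0 := by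
    refine hasOrd_zero_iff.2 ⟨?_, hφ _ h1, ?_⟩
    · rw [Ne, map_eq_zero]
      exact div_ne_zero f0 g0
    · rw [← map_inv₀]
      exact hφ _ h2
  have h4 := h3.mul h
  rwa [← map_mul, div_mul_cancel₀ _ g0, zero_add] at h4

theorem IsDefiningPolynomial.ne_zero {p : Poly} {D : Divisor P1P1}
    (h : IsDefiningPolynomial p D) : p ≠ 0 := by
  rcases h with ⟨C, -, hp, -⟩ | ⟨-, rfl⟩
  exacts [hp.ne_zero, one_ne_zero]

end BlowupSurfaces

end

/-! ### The main theorem -/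

open BlowupSurfaces in
theorem mainTheorem4
    (X X' : BlowupSurfaces.Surface)
    (φ : BlowupSurfaces.DominantRationalMap)
    (D' : Fin 2 → BlowupSurfaces.Divisor X')
    (hlin : BlowupSurfaces.LinearlyEquivalent (D' 0) (D' 1))
    (J : Fin 2 → ℕ)
    (K : (i : Fin 2) → Fin (J i) → ℕ)
    (n : (i : Fin 2) → Fin (J i) → ℤ)
    (E' : (i : Fin 2) → Fin (J i) → BlowupSurfaces.PrimeDivisor X')
    (hE' : ∀ i, Function.Injective (E' i))
    (hD' : ∀ i, D' i = ∑ j : Fin (J i), Finsupp.single (E' i j) (n i j))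
    (m : (i : Fin 2) → (j : Fin (J i)) → Fin (K i j) → ℕ)
    (E : (i : Fin 2) → (j : Fin (J i)) → Fin (K i j) → BlowupSurfaces.PrimeDivisor X)
    (hE : ∀ i j, Function.Injective (E i j))
    (hpull : ∀ i j, BlowupSurfaces.IsPullback φ (Finsupp.single (E' i j) 1)
      (∑ k : Fin (K i j), Finsupp.single (E i j k) (m i j k : ℤ)))
    (p' : (i : Fin 2) → Fin (J i) → BlowupSurfaces.Poly)
    (hp' : ∀ i j, BlowupSurfaces.IsDefiningPolynomial (p' i j)
      (BlowupSurfaces.pushforward (E' i j)))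
    (p : (i : Fin 2) → (j : Fin (J i)) → Fin (K i j) → BlowupSurfaces.Poly)
    (hp : ∀ i j k, BlowupSurfaces.IsDefiningPolynomial (p i j k)
      (BlowupSurfaces.pushforward (E i j k))) :
    ∃ C : ℂ, C ≠ 0 ∧
      φ.pullbackFn
        ((∏ j : Fin (J 0), (p' 0 j).toFn ^ n 0 j) / (∏ j : Fin (J 1), (p' 1 j).toFn ^ n 1 j)) =
      algebraMap ℂ BlowupSurfaces.Fn C *
        ((∏ j : Fin (J 0), (∏ k : Fin (K 0 j), (p 0 j k).toFn ^ m 0 j k) ^ n 0 j) /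
          (∏ j : Fin (J 1), (∏ k : Fin (K 1 j), (p 1 j k).toFn ^ m 1 j k) ^ n 1 j)) := by
  -- Without components all products are `1`. Otherwise some component `(i₀, j₀)` supplies, through
  -- `hpull`, the image point `R` used below.
  by_cases hJ : ∀ i, IsEmpty (Fin (J i))
  · have := hJ 0
    have := hJ 1
    exact ⟨1, one_ne_zero, by simp⟩
  push Not at hJ
  obtain ⟨i₀, ⟨j₀⟩⟩ := hJ
  obtain ⟨F, hF⟩ := hlin
  have hsingle : ∀ {Y : Surface} (A B : PrimeDivisor Y) (k : ℤ),
      (Finsupp.single A k : Divisor Y) B = k * (Finsupp.single A 1 : Divisor Y) B := by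
    intro Y A B k
    classical
    rw [Finsupp.single_apply, Finsupp.single_apply]
    split_ifs <;> simp
  have hD : ∀ i (A : PrimeDivisor X'),
      D' i A = ∑ j, n i j * (Finsupp.single (E' i j) 1 : Divisor X') A := by
    intro i A
    rw [hD' i, Finsupp.finsetSum_apply]
    exact Finset.sum_congr rfl fun j _ => hsingle _ _ _
  have p'0 : ∀ i j, (p' i j).toFn ≠ 0 := fun i j => toFn_ne_zero (hp' i j).ne_zero
  have p0 : ∀ i j k, (p i j k).toFn ≠ 0 := fun i j k => toFn_ne_zero (hp i j k).ne_zero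
  set h : Fin 2 → Fn := fun i => ∏ j, (p' i j).toFn ^ n i j
  set r : Fin 2 → Fn := fun i => ∏ j, (∏ k, (p i j k).toFn ^ m i j k) ^ n i j
  have h0 : ∀ i, h i ≠ 0 := fun i =>
    Finset.prod_ne_zero_iff.2 fun j _ => zpow_ne_zero _ (p'0 i j)
  have r0 : ∀ i, r i ≠ 0 := fun i =>
    Finset.prod_ne_zero_iff.2 fun j _ => zpow_ne_zero _
      (Finset.prod_ne_zero_iff.2 fun k _ => pow_ne_zero _ (p0 i j k))
  -- `T i` is the pull-back of `D' i`, extended linearly from the components.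
  set T : Fin 2 → Divisor X := fun i => ∑ j, n i j • ∑ k, Finsupp.single (E i j k) (m i j k : ℤ)
  -- Having an order along one curve forces `F ≠ 0`; the curve `x = 0` serves.
  obtain ⟨A, -⟩ := exists_primeDivisor X' (irreducible_X_sub_C 0 0)
  have F0 : F ≠ 0 := (hF A).ne_zero
  obtain ⟨c, c0, hc⟩ : ∃ c : ℂ, c ≠ 0 ∧ F = algebraMap ℂ Fn c * (h 0 / h 1) := by
    refine exists_eq_mul_of_hasOrd X' (D' 0 - D' 1) F0 (div_ne_zero (h0 0) (h0 1))
      fun q hq B hB => ⟨hF B, ?_⟩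
    have key : ∀ i, HasOrd B (h i) (D' i B) := fun i => by
      rw [hD]
      exact HasOrd.prod fun j _ => (hasOrd_definingPolynomial hq hB (hp' i j)).zpow _
    exact (key 0).div (key 1)
  obtain ⟨d, d0, hd⟩ : ∃ d : ℂ, d ≠ 0 ∧
      φ.pullbackFn F = algebraMap ℂ Fn d * (r 0 / r 1) := by
    refine exists_eq_mul_of_hasOrd X (T 0 - T 1) (by rwa [Ne, map_eq_zero])
      (div_ne_zero (r0 0) (r0 1)) fun q hq B hB => ⟨?_, ?_⟩
    · obtain ⟨W, hW⟩ := exists_comap_localSubring (φ.pullbackFn : Fn →+* Fn) B.ring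
      obtain ⟨R, hR, hRB, -⟩ := hpull i₀ j₀ B
      -- The image point in `hpull` may depend on the component. All these points are dominated by
      -- `W`, the preimage of the local ring along `B`, so they coincide.
      have hloc : ∀ i j, ∃ g : Fn, IsLocalEquation (Finsupp.single (E' i j) 1) R g ∧
          HasOrd B (φ.pullbackFn g) ((∑ k, Finsupp.single (E i j k) (m i j k : ℤ)) B) := by
        intro i j
        obtain ⟨S, hS, hSB, h⟩ := hpull i j B
        have : S = R := X'.isIteratedBlowup.isSmoothModel.separated S hS R hR W
          (hW S hSB) (hW R hRB)
        rwa [this] at h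
      choose g hg hgB using hloc
      set G : Fin 2 → Fn := fun i => ∏ j, g i j ^ n i j
      have g0 : ∀ i j, g i j ≠ 0 := fun i j => by
        have := (hgB i j).ne_zero
        rwa [Ne, map_eq_zero] at this
      have G0 : ∀ i, G i ≠ 0 := fun i =>
        Finset.prod_ne_zero_iff.2 fun j _ => zpow_ne_zero _ (g0 i j)
      have hG : IsLocalEquation (D' 0 - D' 1) R (G 0 / G 1) := by
        intro A hA
        have key : ∀ i, HasOrd A (G i) (D' i A) := fun i => by
          rw [hD]
          exact HasOrd.prod fun j _ => (hg i j A hA).zpow _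
        exact (key 0).div (key 1)
      -- Both `F` and `G 0 / G 1` are local equations of `D' 0 - D' 1` at `R`, so it suffices to
      -- compute the order with the latter.
      refine IsLocalEquation.hasOrd_pullback hR (fun A _ => hF A) hG F0
        (div_ne_zero (G0 0) (G0 1)) hRB ?_
      have key : ∀ i, HasOrd B (φ.pullbackFn (G i)) (T i B) := fun i => by
        simp only [G, T, map_prod, map_zpow₀, Finsupp.finsetSum_apply, Finsupp.smul_apply,
          smul_eq_mul]
        refine HasOrd.prod fun j _ => HasOrd.zpow ?_ _
        rw [← Finsupp.finsetSum_apply]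
        exact hgB i j
      rw [map_div₀]
      exact (key 0).div (key 1)
    · have key : ∀ i, HasOrd B (r i) (T i B) := fun i => by
        simp only [r, T, Finsupp.finsetSum_apply, Finsupp.smul_apply, smul_eq_mul]
        refine HasOrd.prod fun j _ => HasOrd.zpow (HasOrd.prod fun k _ => ?_) _
        rw [hsingle]
        exact (hasOrd_definingPolynomial hq hB (hp i j k)).pow _
      exact (key 0).div (key 1)
  -- The pull-back of `F` is `c` times that of `h 0 / h 1`, and also `d * (r 0 / r 1)`.
  refine ⟨d / c, div_ne_zero d0 c0, ?_⟩
  change φ.pullbackFn (h 0 / h 1) = _ * (r 0 / r 1)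
  have hc0 : algebraMap ℂ Fn c ≠ 0 := by simpa using c0
  rw [hc, map_mul, AlgHom.commutes] at hd
  rw [map_div₀ (algebraMap ℂ Fn), div_mul_eq_mul_div, ← hd, mul_div_cancel_left₀ _ hc0]
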